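/- Let $q\in\mathbb C^\times$ with $|q|\neq 1$; fix a logarithm $\log q$ of $q$, put $q^x=e^{x\log q}$ and $\tau=\frac{\log q}{2\pi i}$. Let $\mathcal O$ be the algebra of holomorphic functions on $\mathbb C^\times$. Let $A=\mathfrak S_q^{\mathcal O}\otimes M(1|1)$ be the associative superalgebra of $2\times2$ supermatrices whose entries are finite sums $\sum_k z^kf_k(T_q)$ ($k\in\mathbb Z$, $f_k\in\mathcal O$), with product $(z^mf(T_q))(z^kg(T_q))=z^{m+k}f(q^kT_q)g(T_q)$. Here $M_{11},M_{22}$ are the even and $M_{12},M_{21}$ the odd matrix units. For an integer $m\ge0$ let $R_m=\mathbb C[t]/(t^{m+1})$, let $M_\infty[m]$ be the algebra of matrices $(a_{ij})_{i,j\in\mathbb Z}$ over $R_m$ with $a_{ij}=0$ for $|i-j|\gg0$, and let $M_{\infty|\infty}[m]=M_\infty[m]\otimes M(1|1)$. Fix a sign $\varepsilon\in\{1,-1\}$. Give $A$ the principal $\frac12\mathbb Z$-gradation in which $z^kf(T_q)M_{11}$ and $z^kf(T_q)M_{22}$ have degree $k$, $z^kf(T_q)M_{12}$ has degree $k+\frac\varepsilon2$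 and $z^kf(T_q)M_{21}$ has degree $k-\frac\varepsilon2$. Identify $M_{\infty|\infty}[m]$ with the algebra of matrices over $R_m$ indexed by $\frac12\mathbb Z$ with finitely many non-zero diagonals by $$E_{ij}M_{11}=E_{i,j},\quad E_{ij}M_{22}=E_{i+\frac\varepsilon2,\,j+\frac\varepsilon2},\quad E_{ij}M_{12}=E_{i,\,j+\frac\varepsilon2},\quad E_{ij}M_{21}=E_{i+\frac\varepsilon2,\,j}\qquad(i,j\in\mathbb Z),$$ and give it the principal gradation whose component of degree $r$ consists of the matrices supported on the entries $(x,y)$ with $y-x=r$. For $s\in\mathbb C^\times$ let $\varphi_s^{[m]}:A\to M_{\infty|\infty}[m]$ be the linear map $$\varphi_s^{[m]}\bigl(z^kf(T_q)M_{pr}\bigr)=\Bigl(\sum_{j\in\mathbb Z}f(sq^{-j+t})E_{j-k,j}\Bigr)M_{pr},$$ where $f(sq^{-j+t})\in R_m$ is the Taylor expansion in $t$ at $0$ modulo $t^{m+1}$. Let $$I_s^{[m]}=\{f\in\mathcal O: f^{(i)}(sq^n)=0\text{ for all }n\in\mathbb Z,\ 0\le i\le m\},\qquad J_s^{[m]}=\bigoplus_{p,r=1}^2\bigoplus_{k\in\mathbb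 Z}z^kI_s^{[m]}M_{pr}.$$ Let $s_i=q^{a_i}$ ($1\le i\le n$) with $a_i-a_j\notin\mathbb Z+\tau^{-1}\mathbb Z$ for $i\ne j$, let $m_1,\dots,m_n\ge0$ be integers, and put $\varphi_{\vec s}^{[\vec m]}=\bigoplus_i\varphi_{s_i}^{[m_i]}$ and $J_{\vec s}^{[\vec m]}=\bigcap_{i=1}^nJ_{s_i}^{[m_i]}$. Then $$0\longrightarrow J_{\vec s}^{[\vec m]}\longrightarrow A\xrightarrow{\ \varphi_{\vec s}^{[\vec m]}\ }\bigoplus_{i=1}^nM_{\infty|\infty}[m_i]\longrightarrow0$$ is an exact sequence of $\frac12\mathbb Z$-graded associative superalgebras: $A$ and $\bigoplus_iM_{\infty|\infty}[m_i]$ are associative superalgebras with a consistent $\frac12\mathbb Z$-gradation, $J_{\vec s}^{[\vec m]}$ is a two-sided ideal of $A$ that is homogeneous for the $\frac12\mathbb Z$- and the $\mathbb Z/2$-gradation, and $\varphi_{\vec s}^{[\vec m]}$ is a surjective homomorphism of unital algebras that preserves both gradations and has kernel $J_{\vec s}^{[\vec m]}$. -/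

import Mathlib

open Polynomial

noncomputable section

namespace QuantumSuper

/-! ## Holomorphic functions on the punctured plane -/

/-- The extension by `0` to `ℂ` of a function on `ℂˣ = ℂ \ {0}`. -/
def ext0 (f : ℂˣ → ℂ) : ℂ → ℂ := Function.extend Units.val f 0

lemma ext0_val (f : ℂˣ → ℂ) (u : ℂˣ) : ext0 f (u : ℂ) = f u :=
  Units.val_injective.extend_apply f 0 u

lemma ext0_zero (f : ℂˣ → ℂ) : ext0 f 0 = 0 :=
  Function.extend_apply' _ _ _ (fun ⟨u, hu⟩ => u.ne_zero hu)

/-- The algebra `𝒪` of holomorphic functions on `ℂˣ`, with pointwise operations. -/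
def Hol : Subalgebra ℂ (ℂˣ → ℂ) where
  carrier := {f | ∀ u : ℂˣ, DifferentiableAt ℂ (ext0 f) (u : ℂ)}
  mul_mem' := by
    intro f g hf hg u
    have h : ext0 (f * g) = ext0 f * ext0 g := by
      funext z
      by_cases hz : z = 0
      · subst hz; simp [ext0_zero]
      · lift z to ℂˣ using IsUnit.mk0 z hz
        simp [ext0_val]
    rw [h]; exact (hf u).mul (hg u)
  add_mem' := by
    intro f g hf hg u
    have h : ext0 (f + g) = ext0 f + ext0 g := by
      funext z
      by_cases hz : z = 0
      · subst hz; simp [ext0_zero]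
      · lift z to ℂˣ using IsUnit.mk0 z hz
        simp [ext0_val]
    rw [h]; exact (hf u).add (hg u)
  algebraMap_mem' := by
    intro c u
    have h : ext0 (algebraMap ℂ (ℂˣ → ℂ) c) =ᶠ[nhds (u : ℂ)] fun _ => c := by
      filter_upwards [isOpen_ne.mem_nhds u.ne_zero] with z hz
      lift z to ℂˣ using IsUnit.mk0 z hz
      simp [ext0_val]
    exact (differentiableAt_const c).congr_of_eventuallyEq h

/-- The dilation `f(w) ↦ f(c w)` of `𝒪`. -/
def dil (c : ℂˣ) : Hol →ₐ[ℂ] Hol where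
  toFun f := ⟨fun u => f.1 (c * u), by
    intro u
    have h : ext0 (fun u => f.1 (c * u)) = ext0 f.1 ∘ fun z => (c : ℂ) * z := by
      funext z
      by_cases hz : z = 0
      · subst hz; simp [ext0_zero]
      · lift z to ℂˣ using IsUnit.mk0 z hz
        simp only [ext0_val, Function.comp_apply, ← Units.val_mul]
    rw [h]
    refine DifferentiableAt.comp (u : ℂ) ?_ (by fun_prop)
    have := f.2 (c * u)
    rwa [Units.val_mul] at this⟩
  map_one' := rfl
  map_mul' _ _ := rfl
  map_zero' := rfl
  map_add' _ _ := rfl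
  commutes' _ := rfl

lemma dil_one (f : Hol) : dil 1 f = f := by
  apply Subtype.ext; funext u; simp [dil]

lemma dil_dil (c d : ℂˣ) (f : Hol) : dil c (dil d f) = dil (d * c) f := by
  apply Subtype.ext; funext u
  change f.1 (d * (c * u)) = f.1 (d * c * u)
  rw [mul_assoc]

/-! ## Quantum pseudo-differential operators with holomorphic coefficients -/

/-- Finite sums `∑ₖ zᵏ fₖ(T_q)` with `fₖ ∈ 𝒪`; the element is recorded as the finitely supported
family `k ↦ fₖ`. -/
def QPDO (_q : ℂˣ) : Type := ℤ →₀ Hol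

namespace QPDO

variable {q : ℂˣ}

instance : AddCommGroup (QPDO q) := inferInstanceAs (AddCommGroup (ℤ →₀ Hol))
instance : Module ℂ (QPDO q) := inferInstanceAs (Module ℂ (ℤ →₀ Hol))

/-- The finitely supported family `k ↦ fₖ` of `∑ₖ zᵏ fₖ(T_q)`. -/
def coeffs (x : QPDO q) : ℤ →₀ Hol := x

/-- The holomorphic function `fₖ` in `∑ₖ zᵏ fₖ(T_q)`. -/
def coeff (x : QPDO q) (k : ℤ) : Hol := x.coeffs k

/-- The operator `zᵏ f(T_q)`. -/
def mono (k : ℤ) : Hol →+ QPDO q := Finsupp.singleAddHom k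

/-- The additive map on `QPDO q` with prescribed values `φ k f` at `zᵏ f(T_q)`. -/
def lift {B : Type} [AddCommGroup B] (φ : ℤ → Hol →+ B) : QPDO q →+ B := Finsupp.liftAddHom φ

lemma lift_mono {B : Type} [AddCommGroup B] (φ : ℤ → Hol →+ B) (k : ℤ) (f : Hol) :
    lift (q := q) φ (mono k f) = φ k f :=
  Finsupp.liftAddHom_apply_single φ k f

/-- The product, as the biadditive map with
`(zᵐ f(T_q)) (zᵏ g(T_q)) = z^(m+k) f(qᵏ T_q) g(T_q)`. -/
def mulHom : QPDO q →+ QPDO q →+ QPDO q :=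
  lift fun m => AddMonoidHom.flip <| lift fun k => AddMonoidHom.flip <|
    ((AddMonoidHom.mul : Hol →+ Hol →+ Hol).comp
      ((dil (q ^ k) : Hol →ₐ[ℂ] Hol) : Hol →+ Hol)).compr₂ (mono (m + k))

instance : Mul (QPDO q) := ⟨fun x y => mulHom x y⟩
instance : One (QPDO q) := ⟨mono 0 1⟩

lemma mul_def (x y : QPDO q) : x * y = mulHom x y := rfl

lemma mono_mul_mono (m k : ℤ) (f g : Hol) :
    (mono m f * mono k g : QPDO q) = mono (m + k) (dil (q ^ k) f * g) := by
  rw [mul_def, mulHom, lift_mono, AddMonoidHom.flip_apply, lift_mono]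
  rfl

lemma induction_mono {p : QPDO q → Prop} (x : QPDO q) (h0 : p 0)
    (hadd : ∀ x y, p x → p y → p (x + y)) (h1 : ∀ k f, p (mono k f)) : p x :=
  Finsupp.induction_linear (motive := p) x h0 hadd h1

lemma smul_mono (c : ℂ) (k : ℤ) (f : Hol) : c • (mono k f : QPDO q) = mono k (c • f) :=
  Finsupp.smul_single c k f

instance : Ring (QPDO q) :=
  { (inferInstance : AddCommGroup (QPDO q)) with
    mul := (· * ·)
    one := 1
    left_distrib := fun x y z => by simp only [mul_def, map_add]
    right_distrib := fun x y z => by simp only [mul_def, map_add, AddMonoidHom.add_apply]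
    zero_mul := fun x => by simp only [mul_def, map_zero, AddMonoidHom.zero_apply]
    mul_zero := fun x => by simp only [mul_def, map_zero]
    one_mul := fun x => by
      change mulHom (mono 0 1) x = x
      induction x using induction_mono with
      | h0 => simp
      | hadd x y hx hy => rw [map_add, hx, hy]
      | h1 k f => rw [← mul_def, mono_mul_mono]; simp
    mul_one := fun x => by
      change mulHom x (mono 0 1) = x
      induction x using induction_mono with
      | h0 => simp
      | hadd x y hx hy => rw [map_add, AddMonoidHom.add_apply, hx, hy]
      | h1 k f => rw [← mul_def, mono_mul_mono]; simp [dil_one]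
    mul_assoc := fun x y z => by
      change mulHom (mulHom x y) z = mulHom x (mulHom y z)
      induction x using induction_mono with
      | h0 => simp
      | hadd x x' hx hx' => simp only [map_add, AddMonoidHom.add_apply, hx, hx']
      | h1 k f =>
        induction y using induction_mono with
        | h0 => simp
        | hadd y y' hy hy' => simp only [map_add, AddMonoidHom.add_apply, hy, hy']
        | h1 l g =>
          induction z using induction_mono with
          | h0 => simp
          | hadd z z' hz hz' => simp only [map_add, hz, hz']
          | h1 n h =>
            simp only [← mul_def, mono_mul_mono, map_mul, dil_dil, ← zpow_add, add_assoc,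
              mul_assoc] }

instance : Algebra ℂ (QPDO q) := Algebra.ofModule
  (fun c x y => by
    induction x using induction_mono with
    | h0 => simp
    | hadd x x' hx hx' => simp only [smul_add, add_mul, hx, hx']
    | h1 k f =>
      induction y using induction_mono with
      | h0 => simp
      | hadd y y' hy hy' => simp only [smul_add, mul_add, hy, hy']
      | h1 l g => simp only [smul_mono, mono_mul_mono, map_smul, smul_mul_assoc])
  (fun c x y => by
    induction x using induction_mono with
    | h0 => simp
    | hadd x x' hx hx' => simp only [smul_add, add_mul, hx, hx']
    | h1 k f =>
      induction y using induction_mono with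
      | h0 => simp
      | hadd y y' hy hy' => simp only [smul_add, mul_add, hy, hy']
      | h1 l g => simp only [smul_mono, mono_mul_mono, mul_smul_comm])

end QPDO

/-- The superalgebra `𝔖_q^𝒪 ⊗ M(1|1)` of `2 × 2` supermatrices; the indices `0, 1 : Fin 2` stand
for the rows and columns `1, 2`. -/
abbrev SQPDO (q : ℂˣ) : Type := Matrix (Fin 2) (Fin 2) (QPDO q)

/-! ## Infinite matrices with finitely many non-zero diagonals -/

/-- The matrices `(a i j)`, `i, j ∈ ℤ`, over `R` with `a i j = 0` for `|i - j| ≫ 0`. -/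
def Band (R : Type) [CommRing R] [Algebra ℂ R] : Submodule ℂ (Matrix ℤ ℤ R) where
  carrier := {a | ∃ N : ℕ, ∀ i j : ℤ, (N : ℤ) < |i - j| → a i j = 0}
  zero_mem' := ⟨0, fun _ _ _ => rfl⟩
  add_mem' := by
    rintro a b ⟨N, hN⟩ ⟨K, hK⟩
    refine ⟨N + K, fun i j h => ?_⟩
    push_cast at h
    rw [Matrix.add_apply, hN i j (by omega), hK i j (by omega), add_zero]
  smul_mem' := by
    rintro c a ⟨N, hN⟩
    exact ⟨N, fun i j h => by rw [Matrix.smul_apply, hN i j h, smul_zero]⟩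

namespace Band

variable {R : Type} [CommRing R] [Algebra ℂ R]

lemma finsum_eq {R : Type} [CommRing R] {a : Matrix ℤ ℤ R} {N : ℕ} (ha : ∀ i j : ℤ, (N : ℤ) < |i - j| → a i j = 0)
    (b : Matrix ℤ ℤ R) (i j : ℤ) (S : Finset ℤ) (hS : Finset.Icc (i - N) (i + N) ⊆ S) :
    ∑ᶠ k, a i k * b k j = ∑ k ∈ S, a i k * b k j := by
  apply finsum_eq_sum_of_support_subset
  intro k hk
  apply hS
  by_contra hk'
  apply hk
  simp only [Finset.mem_Icc, not_and_or, not_le] at hk'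
  change a i k * b k j = 0
  rw [ha i k (by rw [lt_abs]; omega), zero_mul]

/-- The usual matrix product; each sum has only finitely many non-zero terms. -/
instance : Mul (Band R) := ⟨fun a b => ⟨fun i j => ∑ᶠ k, a.1 i k * b.1 k j, by
  obtain ⟨N, hN⟩ := a.2
  obtain ⟨K, hK⟩ := b.2
  refine ⟨N + K, fun i j h => ?_⟩
  rw [← finsum_zero (α := ℤ)]
  refine finsum_congr fun k => ?_
  push_cast at h
  by_cases h1 : (N : ℤ) < |i - k|
  · rw [hN i k h1, zero_mul]
  · rw [hK k j ?_, mul_zero]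
    have := abs_sub_le i k j
    omega⟩⟩

instance : One (Band R) := ⟨⟨1, 0, fun i j h => Matrix.one_apply_ne (by rintro rfl; simp at h)⟩⟩

lemma mul_apply (a b : Band R) (i j : ℤ) : (a * b).1 i j = ∑ᶠ k, a.1 i k * b.1 k j := rfl

lemma one_val : (1 : Band R).1 = 1 := rfl

lemma exists_sum (a : Band R) : ∃ N : ℕ, ∀ (b : Band R) (i j : ℤ) (S : Finset ℤ),
    Finset.Icc (i - N) (i + N) ⊆ S → (a * b).1 i j = ∑ k ∈ S, a.1 i k * b.1 k j := by
  obtain ⟨N, hN⟩ := a.2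
  exact ⟨N, fun b i j S hS => finsum_eq hN b.1 i j S hS⟩

instance : Ring (Band R) :=
  { (inferInstance : AddCommGroup (Band R)) with
    mul := (· * ·)
    one := 1
    left_distrib := fun a b c => by
      obtain ⟨N, hN⟩ := exists_sum a
      ext i j
      change (a * (b + c)).1 i j = (a * b).1 i j + (a * c).1 i j
      simp only [hN _ i j _ subset_rfl, Submodule.coe_add, Matrix.add_apply, mul_add,
        Finset.sum_add_distrib]
    right_distrib := fun a b c => by
      obtain ⟨N, hN⟩ := exists_sum a
      obtain ⟨K, hK⟩ := exists_sum b
      obtain ⟨L, hL⟩ := exists_sum (a + b)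
      ext i j
      change ((a + b) * c).1 i j = (a * c).1 i j + (b * c).1 i j
      have h : ∀ M : ℕ, M ≤ N + K + L →
          Finset.Icc (i - M) (i + M) ⊆ Finset.Icc (i - ↑(N + K + L)) (i + ↑(N + K + L)) :=
        fun M hM => Finset.Icc_subset_Icc (by omega) (by omega)
      rw [hN c i j _ (h N (by omega)), hK c i j _ (h K (by omega)), hL c i j _ (h L (by omega))]
      simp only [Submodule.coe_add, Matrix.add_apply, add_mul, Finset.sum_add_distrib]
    zero_mul := fun a => by
      ext i j
      change ∑ᶠ k, (0 : R) * a.1 k j = 0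
      simp
    mul_zero := fun a => by
      ext i j
      change ∑ᶠ k, a.1 i k * (0 : R) = 0
      simp
    one_mul := fun a => by
      obtain ⟨N, hN⟩ := exists_sum (1 : Band R)
      ext i j
      change (1 * a).1 i j = _
      rw [hN a i j _ subset_rfl, one_val,
        Finset.sum_eq_single i (fun k _ hk => by rw [Matrix.one_apply_ne hk.symm, zero_mul])
          (fun h => absurd (Finset.mem_Icc.2 ⟨by omega, by omega⟩) h),
        Matrix.one_apply_eq, one_mul]
    mul_one := fun a => by
      obtain ⟨N, hN⟩ := exists_sum a
      ext i j
      change (a * 1).1 i j = _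
      rw [hN 1 i j (insert j (Finset.Icc (i - N) (i + N))) (Finset.subset_insert _ _), one_val,
        Finset.sum_eq_single j (fun k _ hk => by rw [Matrix.one_apply_ne hk, mul_zero])
          (fun h => absurd (Finset.mem_insert_self _ _) h),
        Matrix.one_apply_eq, mul_one]
    mul_assoc := fun a b c => by
      obtain ⟨N, hN⟩ := exists_sum a
      obtain ⟨K, hK⟩ := exists_sum b
      obtain ⟨L, hL⟩ := exists_sum (a * b)
      ext i j
      change (a * b * c).1 i j = (a * (b * c)).1 i j
      rw [hN (b * c) i j _ subset_rfl, hL c i j (Finset.Icc (i - ↑(N + K + L)) (i + ↑(N + K + L)))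
        (Finset.Icc_subset_Icc (by omega) (by omega))]
      have h : ∀ l ∈ Finset.Icc (i - (N : ℤ)) (i + N), a.1 i l * (b * c).1 l j =
          ∑ k ∈ Finset.Icc (i - ↑(N + K + L)) (i + ↑(N + K + L)),
            a.1 i l * b.1 l k * c.1 k j := by
        intro l hl
        rw [Finset.mem_Icc] at hl
        rw [hK c l j (Finset.Icc (i - ↑(N + K + L)) (i + ↑(N + K + L)))
          (Finset.Icc_subset_Icc (by push_cast; omega) (by push_cast; omega)), Finset.mul_sum]
        simp only [mul_assoc]
      rw [Finset.sum_congr rfl h, Finset.sum_comm]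
      refine Finset.sum_congr rfl fun k _ => ?_
      rw [hN b i k _ subset_rfl, Finset.sum_mul] }

instance : Algebra ℂ (Band R) := Algebra.ofModule
  (fun c a b => by
    obtain ⟨N, hN⟩ := exists_sum a
    obtain ⟨K, hK⟩ := exists_sum (c • a)
    ext i j
    have h : ∀ M : ℕ, M ≤ N + K →
        Finset.Icc (i - M) (i + M) ⊆ Finset.Icc (i - ↑(N + K)) (i + ↑(N + K)) :=
      fun M hM => Finset.Icc_subset_Icc (by omega) (by omega)
    change (c • a * b).1 i j = c • (a * b).1 i j
    rw [hN b i j _ (h N (by omega)), hK b i j _ (h K (by omega)), Finset.smul_sum]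
    refine Finset.sum_congr rfl fun k _ => ?_
    rw [Submodule.coe_smul, Matrix.smul_apply, smul_mul_assoc])
  (fun c a b => by
    obtain ⟨N, hN⟩ := exists_sum a
    ext i j
    change (a * c • b).1 i j = c • (a * b).1 i j
    rw [hN _ i j _ subset_rfl, hN _ i j _ subset_rfl, Finset.smul_sum]
    refine Finset.sum_congr rfl fun k _ => ?_
    rw [Submodule.coe_smul, Matrix.smul_apply, mul_smul_comm])

end Band

/-- The truncated polynomial algebra `R_m = ℂ[t]/(t^(m+1))`. -/
abbrev TruncPoly (m : ℕ) : Type := ℂ[X] ⧸ Ideal.span {(X : ℂ[X]) ^ (m + 1)}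

/-- The superalgebra `M_{∞|∞}[m] = M_∞[m] ⊗ M(1|1)`, in `2 × 2` block form. -/
abbrev MInf (m : ℕ) : Type := Matrix (Fin 2) (Fin 2) (Band (TruncPoly m))

/-! ## The homomorphism and the ideals -/

/-- The nonzero number `exp z`. -/
def expU (z : ℂ) : ℂˣ := Units.mk0 (Complex.exp z) (Complex.exp_ne_zero z)

/-- `f(u qᵗ) ∈ R_m` where `qᵗ = exp (t log q)`: the Taylor expansion in `t` at `0`,
truncated modulo `t^(m+1)`. -/
def jet (logq : ℂ) (m : ℕ) (u : ℂˣ) (f : Hol) : TruncPoly m :=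
  Ideal.Quotient.mk _ (∑ i ∈ Finset.range (m + 1),
    C (iteratedDeriv i (fun t : ℂ => f.1 (u * expU (t * logq))) 0 / (i.factorial : ℂ)) * X ^ i)

lemma jet_zero (logq : ℂ) (m : ℕ) (u : ℂˣ) : jet logq m u 0 = 0 := by
  have h : ∀ i : ℕ, iteratedDeriv i
      (fun t : ℂ => (0 : Hol).1 (u * expU (t * logq))) 0 = 0 := fun i => by
    change iteratedDeriv i (fun _ : ℂ => (0 : ℂ)) 0 = 0
    simp
  simp only [jet, h]
  simp

/-- `zᵏ f(T_q) ↦ ∑_j f(s q^(-j+t)) E_{j-k, j}`, extended additively: the entry of the image of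
`∑ₖ zᵏ fₖ(T_q)` in row `i` and column `j` is `f_{j-i}(s q^(-j+t))`. -/
def phiEntry {q : ℂˣ} (logq : ℂ) (s : ℂˣ) (m : ℕ) (x : QPDO q) : Band (TruncPoly m) :=
  ⟨fun i j => jet logq m (s * q ^ (-j)) (x.coeff (j - i)), by
    refine ⟨∑ k ∈ x.coeffs.support, k.natAbs, fun i j h => ?_⟩
    have h0 : x.coeff (j - i) = 0 := by
      by_contra h1
      have h2 : j - i ∈ x.coeffs.support := Finsupp.mem_support_iff.2 h1
      have := Finset.single_le_sum (f := fun k : ℤ => k.natAbs) (fun _ _ => Nat.zero_le _) h2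
      change (j - i).natAbs ≤ ∑ k ∈ x.coeffs.support, k.natAbs at this
      rw [abs_sub_comm, Int.abs_eq_natAbs] at h
      omega
    change jet logq m (s * q ^ (-j)) (x.coeff (j - i)) = 0
    rw [h0, jet_zero]⟩

/-- The map `φ_s^{[m]}`, in block form:
`zᵏ f(T_q) M_{pr} ↦ (∑_j f(s q^(-j+t)) E_{j-k, j}) M_{pr}`. -/
def phi {q : ℂˣ} (logq : ℂ) (s : ℂˣ) (m : ℕ) (A : SQPDO q) : MInf m :=
  fun p r => phiEntry logq s m (A p r)

/-- `I_s^{[m]}`: the functions in `𝒪` that vanish together with their first `m` derivatives at all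
the points `s qⁿ`, `n ∈ ℤ`. -/
def idealI (q s : ℂˣ) (m : ℕ) : Set Hol :=
  {f | ∀ n : ℤ, ∀ i ≤ m, iteratedDeriv i (ext0 f.1) ((s * q ^ n : ℂˣ) : ℂ) = 0}

lemma contDiffAt_ext0 (f : Hol) (u : ℂˣ) (i : ℕ) : ContDiffAt ℂ i (ext0 f.1) (u : ℂ) := by
  have h : DifferentiableOn ℂ (ext0 f.1) {0}ᶜ := fun z hz => by
    lift z to ℂˣ using IsUnit.mk0 z hz
    exact (f.2 z).differentiableWithinAt
  exact (h.analyticAt (isOpen_compl_singleton.mem_nhds u.ne_zero)).contDiffAt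

lemma ext0_coe_add (f g : Hol) : ext0 (f + g : Hol).1 = ext0 f.1 + ext0 g.1 := by
  funext z
  by_cases hz : z = 0
  · subst hz; simp [ext0_zero]
  · lift z to ℂˣ using IsUnit.mk0 z hz
    simp [ext0_val]

lemma ext0_coe_smul (c : ℂ) (f : Hol) : ext0 (c • f : Hol).1 = c • ext0 f.1 := by
  funext z
  by_cases hz : z = 0
  · subst hz; simp [ext0_zero]
  · lift z to ℂˣ using IsUnit.mk0 z hz
    simp [ext0_val]

lemma ext0_coe_zero : ext0 (0 : Hol).1 = fun _ => 0 := by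
  simpa [Pi.zero_def] using ext0_coe_smul 0 0

/-- `J_s^{[m]} = ⨁_{p,r} ⨁_k zᵏ I_s^{[m]} M_{pr}`: all coefficients of all entries lie in
`I_s^{[m]}`. -/
def idealJ (q s : ℂˣ) (m : ℕ) : Submodule ℂ (SQPDO q) where
  carrier := {A | ∀ (p r : Fin 2) (k : ℤ), (A p r).coeff k ∈ idealI q s m}
  zero_mem' := by
    intro p r k n i _
    change iteratedDeriv i (ext0 (0 : Hol).1) _ = 0
    rw [ext0_coe_zero]
    simp
  add_mem' := by
    intro A B hA hB p r k n i hi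
    change iteratedDeriv i (ext0 ((A p r).coeff k + (B p r).coeff k : Hol).1) _ = 0
    rw [ext0_coe_add, iteratedDeriv_add (contDiffAt_ext0 _ _ _) (contDiffAt_ext0 _ _ _),
      hA p r k n i hi, hB p r k n i hi, add_zero]
  smul_mem' := by
    intro c A hA p r k n i hi
    change iteratedDeriv i (ext0 (c • (A p r).coeff k : Hol).1) _ = 0
    rw [ext0_coe_smul, iteratedDeriv_const_smul (contDiffAt_ext0 _ _ _), hA p r k n i hi,
      smul_zero]

/-! ## Gradations -/

/-- The group `½ℤ`. -/
abbrev HalfInt : Type := AddSubgroup.zmultiples (1 / 2 : ℚ)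

/-- Given a `½ℤ`-gradation `𝒜` and a `ℤ/2`-gradation `P` of an algebra `A`: the axioms of a
superalgebra with a consistent `½ℤ`-gradation. -/
structure IsHalfIntGradedSuperalgebra {A : Type} [Ring A] [Algebra ℂ A]
    (𝒜 : HalfInt → Submodule ℂ A) (P : ZMod 2 → Submodule ℂ A) : Prop where
  parity_gradedMonoid : SetLike.GradedMonoid P
  parity_internal : DirectSum.IsInternal P
  gradedMonoid : SetLike.GradedMonoid 𝒜
  internal : DirectSum.IsInternal 𝒜
  even_eq : P 0 = ⨆ (α : HalfInt) (_ : ∃ n : ℤ, (α : ℚ) = n), 𝒜 α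
  odd_eq : P 1 = ⨆ (α : HalfInt) (_ : ∃ n : ℤ, (α : ℚ) = n + 1 / 2), 𝒜 α

/-- The `ℤ/2`-gradation of `2 × 2` supermatrices: diagonal entries are even, the others odd. -/
def parity (B : Type) [AddCommGroup B] [Module ℂ B] (π : ZMod 2) :
    Submodule ℂ (Matrix (Fin 2) (Fin 2) B) where
  carrier := {A | ∀ p r : Fin 2, A p r ≠ 0 → π = if p = r then 0 else 1}
  zero_mem' := fun _ _ h => absurd rfl h
  add_mem' := by
    intro A B hA hB p r h
    by_cases h1 : A p r = 0
    · exact hB p r (fun h2 => h (by rw [Matrix.add_apply, h1, h2, add_zero]))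
    · exact hA p r h1
  smul_mem' := by
    intro c A hA p r h
    exact hA p r (fun h2 => h (by rw [Matrix.smul_apply, h2, smul_zero]))

/-- The principal gradation of the quantum pseudo-differential superalgebra, for a sign `ε`:
`zᵏ f(T_q) M_{pr}` has degree `k + ε (r - p) / 2`. -/
def gradeS {q : ℂˣ} (ε : ℤˣ) (α : HalfInt) : Submodule ℂ (SQPDO q) where
  carrier := {A | ∀ (p r : Fin 2) (k : ℤ), (A p r).coeff k ≠ 0 →
    (α : ℚ) = k + ((ε : ℤ) : ℚ) * (((r : ℕ) : ℚ) - ((p : ℕ) : ℚ)) / 2}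
  zero_mem' := fun _ _ _ h => absurd rfl h
  add_mem' := by
    intro A B hA hB p r k h
    by_cases h1 : (A p r).coeff k = 0
    · refine hB p r k (fun h2 => h ?_)
      change (A p r).coeff k + (B p r).coeff k = 0
      rw [h1, h2, add_zero]
    · exact hA p r k h1
  smul_mem' := by
    intro c A hA p r k h
    refine hA p r k (fun h2 => h ?_)
    change c • (A p r).coeff k = 0
    rw [h2, smul_zero]

/-- The half-integer that labels row (or column) `i` of the `p`-th block when `M_{∞|∞}[m]` is
viewed as an algebra of matrices indexed by `½ℤ`: the matrix `E_{ij} M_{pr}` becomes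
`E_{pos p i, pos r j}`, for instance `E_{ij} M_{22}` becomes `E_{i+ε/2, j+ε/2}`. -/
def pos (ε : ℤˣ) (p : Fin 2) (i : ℤ) : ℚ := i + ((ε : ℤ) : ℚ) * ((p : ℕ) : ℚ) / 2

/-- The principal gradation of `M_{∞|∞}[m]`: in terms of the indexing by `½ℤ`, the matrices of
degree `α` are those supported on the entries `(x, y)` with `y - x = α`. -/
def gradeM {m : ℕ} (ε : ℤˣ) (α : HalfInt) : Submodule ℂ (MInf m) where
  carrier := {A | ∀ (p r : Fin 2) (i j : ℤ), (A p r).1 i j ≠ 0 →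
    pos ε r j - pos ε p i = (α : ℚ)}
  zero_mem' := fun _ _ _ _ h => absurd rfl h
  add_mem' := by
    intro A B hA hB p r i j h
    by_cases h1 : (A p r).1 i j = 0
    · refine hB p r i j (fun h2 => h ?_)
      change (A p r).1 i j + (B p r).1 i j = 0
      rw [h1, h2, add_zero]
    · exact hA p r i j h1
  smul_mem' := by
    intro c A hA p r i j h
    refine hA p r i j (fun h2 => h ?_)
    change c • (A p r).1 i j = 0
    rw [h2, smul_zero]

end QuantumSuper

end

/-! Everything rests on the jet map $f\mapsto f(uq^t)\in R_m$ (`jetHom`). By the Leibniz rule it is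
an algebra homomorphism. Since $\log q\ne0$, the map $t\mapsto uq^t$ is locally biholomorphic at
$0$, so the kernel consists of the $f$ that vanish to order $m+1$ at $u$ (`jetHom_eq_zero_iff`).
Entry by entry this identifies the kernel of $\varphi$ with $J$, which is therefore an ideal.
Multiplicativity of $\varphi$ holds because a dilation by $q^k$ moves the base point of a jet $k$
steps along the orbit (`jet_dil`).

Surjectivity is an interpolation problem. The $k$-th diagonals of the target matrices involve only
the coefficient of $z^k$, so one needs a single $f\in\mathcal O$ with prescribed jets at all points
$s_iq^{-j}$. The hypothesis on the $a_i$ makes these points distinct (`orbit_injective`), and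
$|q|\ne1$ makes them accumulate only at $0$ and $\infty$ (`tendsto_abs_log_norm_orbit`). Enumerate
them as $p_0,p_1,\dots$ and put $f=\sum_kg_k$, in the manner of Mittag-Leffler: $g_k$ corrects the
jet at $p_k$, has zero jet at the earlier points, and is at most $2^{-k}$ on an annulus that
exhausts $\mathbb C^\times$ as $k\to\infty$ (`exists_small_correction`, `exists_hol_jetHom_eq`).
Weierstrass' theorem on derivatives carries the jets over to the limit.

The statements on gradations are formal: every homogeneous part is cut out by the vanishing of
coordinates of the wrong degree, and this is treated once for all in `IsCoordGrading`. -/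

noncomputable section

namespace QuantumSuper

/-! ## Gradations given by coordinates -/

/-- A separating family of coordinates `c i` on `M`, each of which is given a degree, such that
every element has coordinates of finitely many degrees and has homogeneous components. -/
structure IsCoordGrading {Γ M ι : Type} {W : ι → Type} [AddCommGroup M]
    [∀ i, AddCommGroup (W i)] (c : ∀ i, M →+ W i) (deg : ι → Γ) : Prop where
  sep : ∀ x, (∀ i, c i x = 0) → x = 0
  finite : ∀ x, ∃ S : Finset Γ, ∀ i, c i x ≠ 0 → deg i ∈ S
  proj : ∀ α x, ∃ y, (∀ i, deg i = α → c i y = c i x) ∧ ∀ i, deg i ≠ α → c i y = 0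

namespace IsCoordGrading

variable {Γ M ι : Type} {W : ι → Type} [AddCommGroup M]
  [∀ i, AddCommGroup (W i)] {c : ∀ i, M →+ W i} {deg : ι → Γ}

lemma exists_sum (h : IsCoordGrading c deg) (x : M) : ∃ (S : Finset Γ) (y : Γ → M),
    (∀ α, (∀ i, deg i = α → c i (y α) = c i x) ∧ ∀ i, deg i ≠ α → c i (y α) = 0) ∧
    x = ∑ α ∈ S, y α := by
  obtain ⟨S, hS⟩ := h.finite x
  choose y hy using fun α => h.proj α x
  refine ⟨S, y, hy, sub_eq_zero.1 (h.sep _ fun i => ?_)⟩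
  rw [map_sub, map_sum, sub_eq_zero]
  by_cases hi : c i x = 0
  · rw [hi, Finset.sum_eq_zero]
    intro α _
    by_cases hα : deg i = α
    · rw [(hy α).1 i hα, hi]
    · exact (hy α).2 i hα
  · rw [Finset.sum_eq_single (deg i) (fun α _ hα => (hy α).2 i hα.symm)
      (fun h' => absurd (hS i hi) h')]
    exact ((hy _).1 i rfl).symm

variable [Module ℂ M]

/-- A given coordinate is nonzero on at most one homogeneous summand, so a vanishing sum has
vanishing summands; the components supplied by `exists_sum` give surjectivity. -/
lemma isInternal [DecidableEq Γ] (h : IsCoordGrading c deg) (𝒜 : Γ → Submodule ℂ M)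
    (h𝒜 : ∀ α x, x ∈ 𝒜 α ↔ ∀ i, c i x ≠ 0 → deg i = α) : DirectSum.IsInternal 𝒜 := by
  constructor
  · rw [injective_iff_map_eq_zero]
    intro v hv
    classical
    rw [DirectSum.coeAddMonoidHom_eq_dfinsuppSum, DFinsupp.sum] at hv
    ext α : 1
    apply Subtype.ext
    refine h.sep _ fun i => ?_
    by_contra hi
    have hα := (h𝒜 α _).1 (v α).2 i hi
    apply hi
    have h1 := congrArg (c i) hv
    rw [map_sum, map_zero, Finset.sum_eq_single α] at h1
    · exact h1
    · intro β _ hβ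
      by_contra h2
      exact hβ (((h𝒜 β _).1 (v β).2 i h2).symm.trans hα)
    · intro h2
      rw [DFinsupp.notMem_support_iff.1 h2]
      simp
  · intro x
    obtain ⟨S, y, hy, rfl⟩ := h.exists_sum x
    have hmem : ∀ α, y α ∈ 𝒜 α := fun α => (h𝒜 α _).2 fun i hi => by
      by_contra h2
      exact hi ((hy α).2 i h2)
    refine ⟨∑ α ∈ S, DirectSum.of (fun α => 𝒜 α) α ⟨y α, hmem α⟩, ?_⟩
    rw [map_sum]
    exact Finset.sum_congr rfl fun α _ => DirectSum.coeAddMonoidHom_of 𝒜 α _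

/-- A homogeneous component arises by setting some coordinates to zero, so closure of `J` under this
operation makes it a graded subspace. -/
lemma eq_iSup_inf (h : IsCoordGrading c deg) (𝒜 : Γ → Submodule ℂ M)
    (h𝒜 : ∀ α x, x ∈ 𝒜 α ↔ ∀ i, c i x ≠ 0 → deg i = α) (J : Submodule ℂ M)
    (hJ : ∀ x ∈ J, ∀ y, (∀ i, c i y = c i x ∨ c i y = 0) → y ∈ J) :
    J = ⨆ α, J ⊓ 𝒜 α := by
  refine le_antisymm (fun x hx => ?_) (iSup_le fun α => inf_le_left)
  obtain ⟨S, y, hy, hsum⟩ := h.exists_sum x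
  rw [hsum]
  refine Submodule.sum_mem _ fun α _ => Submodule.mem_iSup_of_mem α ⟨hJ x hx _ fun i => ?_, ?_⟩
  · by_cases hi : deg i = α
    · exact .inl ((hy α).1 i hi)
    · exact .inr ((hy α).2 i hi)
  · exact (h𝒜 α _).2 fun i hi => by
      by_contra h2
      exact hi ((hy α).2 i h2)

lemma eq_iSup_of_mem_iff (h : IsCoordGrading c deg) (𝒜 : Γ → Submodule ℂ M)
    (h𝒜 : ∀ α x, x ∈ 𝒜 α ↔ ∀ i, c i x ≠ 0 → deg i = α) (P : Submodule ℂ M) (Q : Γ → Prop)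
    (hP : ∀ x, x ∈ P ↔ ∀ i, c i x ≠ 0 → Q (deg i)) :
    P = ⨆ (α) (_ : Q α), 𝒜 α := by
  apply le_antisymm
  · rw [h.eq_iSup_inf 𝒜 h𝒜 P]
    · refine iSup_le fun α => ?_
      by_cases hα : Q α
      · exact inf_le_right.trans (le_iSup₂_of_le α hα le_rfl)
      · rintro x ⟨hx, hx'⟩
        rw [h.sep x]
        · exact Submodule.zero_mem _
        · intro i
          by_contra hi
          exact hα ((h𝒜 α x).1 hx' i hi ▸ (hP x).1 hx i hi)
    · intro x hx y hy
      rw [hP] at hx ⊢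
      intro i hi
      rcases hy i with h1 | h1
      · exact hx i (h1 ▸ hi)
      · exact absurd h1 hi
  · refine iSup₂_le fun α hα x hx => (hP x).2 fun i hi => ?_
    rw [(h𝒜 α x).1 hx i hi]
    exact hα

end IsCoordGrading

/-! ## The degrees -/

/-- The half-integer `k + ε d / 2`. -/
def halfDeg (ε : ℤˣ) (k d : ℤ) : HalfInt :=
  ⟨k + ((ε : ℤ) : ℚ) * d / 2, AddSubgroup.mem_zmultiples_iff.2 ⟨2 * k + ε * d, by
    rw [zsmul_eq_mul]; push_cast; ring⟩⟩

lemma halfDeg_val (ε : ℤˣ) (k d : ℤ) : (halfDeg ε k d : ℚ) = k + ((ε : ℤ) : ℚ) * d / 2 := rfl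

/-- The degree of `z⁰ f(T_q) M_{pr}` in units of `ε / 2`. -/
def blockDeg (p r : Fin 2) : ℤ := ((r : ℕ) : ℤ) - ((p : ℕ) : ℤ)

/-- After doubling, this is the parity of $2k+\varepsilon(r-p)$ with $r-p\in\{0,\pm1\}$. -/
lemma halfDeg_int_iff (ε : ℤˣ) (k : ℤ) (p r : Fin 2) :
    (∃ n : ℤ, (halfDeg ε k (blockDeg p r) : ℚ) = n) ↔ p = r := by
  have key : ∀ n : ℤ, (halfDeg ε k (blockDeg p r) : ℚ) = n ↔
      2 * k + (ε : ℤ) * blockDeg p r = 2 * n := by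
    intro n
    rw [halfDeg_val, ← @Int.cast_inj ℚ]
    push_cast
    constructor <;> intro h <;> linarith
  simp only [key]
  rcases Int.units_eq_one_or ε with rfl | rfl <;> fin_cases p <;> fin_cases r <;>
    simp [blockDeg] <;> first | exact ⟨k, rfl⟩ | (intro x; omega)

lemma halfDeg_half_iff (ε : ℤˣ) (k : ℤ) (p r : Fin 2) :
    (∃ n : ℤ, (halfDeg ε k (blockDeg p r) : ℚ) = n + 1 / 2) ↔ p ≠ r := by
  have key : ∀ n : ℤ, (halfDeg ε k (blockDeg p r) : ℚ) = n + 1 / 2 ↔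
      2 * k + (ε : ℤ) * blockDeg p r = 2 * n + 1 := by
    intro n
    rw [halfDeg_val, ← @Int.cast_inj ℚ]
    push_cast
    constructor <;> intro h <;> linarith
  simp only [key]
  rcases Int.units_eq_one_or ε with rfl | rfl <;> fin_cases p <;> fin_cases r <;>
    simp [blockDeg] <;>
    -- Off the diagonal the degree is $k\pm\frac12$, hence the two candidates for the integer.
    first | (intro x; omega) | exact ⟨k, by omega⟩ | exact ⟨k - 1, by omega⟩

/-! ## Parity of supermatrices -/

lemma mem_parity {B : Type} [AddCommGroup B] [Module ℂ B] {π : ZMod 2}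
    {A : Matrix (Fin 2) (Fin 2) B} :
    A ∈ parity B π ↔ ∀ p r : Fin 2, A p r ≠ 0 → (if p = r then 0 else 1 : ZMod 2) = π :=
  ⟨fun h p r h' => (h p r h').symm, fun h p r h' => (h p r h').symm⟩

lemma parity_one_mem (B : Type) [Ring B] [Algebra ℂ B] :
    (1 : Matrix (Fin 2) (Fin 2) B) ∈ parity B 0 := by
  rw [mem_parity]
  intro p r h
  by_cases hpr : p = r
  · simp [hpr]
  · exact absurd (Matrix.one_apply_ne hpr) h

lemma exists_ne_zero_of_mul_apply_ne_zero {B : Type} [Ring B] {x y : Matrix (Fin 2) (Fin 2) B}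
    {p r : Fin 2} (h : (x * y) p r ≠ 0) : ∃ l, x p l * y l r ≠ 0 := by
  rw [Matrix.mul_apply] at h
  obtain ⟨l, -, hl⟩ := Finset.exists_ne_zero_of_sum_ne_zero h
  exact ⟨l, hl⟩

lemma parity_mul_mem {B : Type} [Ring B] [Algebra ℂ B] {π ρ : ZMod 2}
    {x y : Matrix (Fin 2) (Fin 2) B} (hx : x ∈ parity B π) (hy : y ∈ parity B ρ) :
    x * y ∈ parity B (π + ρ) := by
  rw [mem_parity] at *
  intro p r h
  obtain ⟨l, hl⟩ := exists_ne_zero_of_mul_apply_ne_zero h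
  rw [← hx p l (left_ne_zero_of_mul hl), ← hy l r (right_ne_zero_of_mul hl)]
  clear hl h hx hy
  revert p l r
  decide

/-- The `(p, r)` entry of a supermatrix. -/
def entryHom (B : Type) [AddCommGroup B] (p r : Fin 2) : Matrix (Fin 2) (Fin 2) B →+ B where
  toFun A := A p r
  map_zero' := rfl
  map_add' _ _ := rfl

lemma isCoordGrading_parity {N : Type} (B : N → Type) [∀ i, AddCommGroup (B i)] :
    IsCoordGrading (M := (i : N) → Matrix (Fin 2) (Fin 2) (B i))
      (W := fun a : N × Fin 2 × Fin 2 => B a.1)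
      (fun a => (entryHom (B a.1) a.2.1 a.2.2).comp (Pi.evalAddMonoidHom _ a.1))
      (fun a => (if a.2.1 = a.2.2 then 0 else 1 : ZMod 2)) where
  sep x h := by
    funext i
    ext p r
    exact h (i, p, r)
  finite x := ⟨Finset.univ, fun _ _ => Finset.mem_univ _⟩
  proj α x := by
    refine ⟨fun i p r => if (if p = r then 0 else 1 : ZMod 2) = α then x i p r else 0,
      fun i hi => ?_, fun i hi => ?_⟩
    · exact if_pos hi
    · exact if_neg hi

lemma isCoordGrading_parity_single (B : Type) [AddCommGroup B] :
    IsCoordGrading (M := Matrix (Fin 2) (Fin 2) B)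
      (W := fun _ : Fin 2 × Fin 2 => B)
      (fun a => entryHom B a.1 a.2)
      (fun a => (if a.1 = a.2 then 0 else 1 : ZMod 2)) where
  sep x h := by
    ext p r
    exact h (p, r)
  finite x := ⟨Finset.univ, fun _ _ => Finset.mem_univ _⟩
  proj α x := by
    refine ⟨fun p r => if (if p = r then 0 else 1 : ZMod 2) = α then x p r else 0,
      fun i hi => ?_, fun i hi => ?_⟩
    · exact if_pos hi
    · exact if_neg hi

/-! ## The gradation of the quantum pseudo-differential superalgebra -/

namespace QPDO

variable {q : ℂˣ}

lemma coeff_mono (k l : ℤ) (f : Hol) :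
    (mono k f : QPDO q).coeff l = if k = l then f else 0 := by
  classical
  exact Finsupp.single_apply

/-- The coefficient of `zᵏ`. -/
def coeffHom (k : ℤ) : QPDO q →+ Hol := Finsupp.applyAddHom k

lemma coeffHom_apply (k : ℤ) (x : QPDO q) : coeffHom k x = x.coeff k := rfl

lemma eq_zero_of_coeff {x : QPDO q} (h : ∀ k, x.coeff k = 0) : x = 0 := Finsupp.ext h

lemma eq_sum_mono (x : QPDO q) : x = ∑ k ∈ x.coeffs.support, mono k (x.coeff k) :=
  (Finsupp.sum_single x).symm

/-- After expansion into monomials, each product of terms in $z^a$ and $z^b$ lies in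
$z^{a+b}\mathcal O$. The twist by a dilation does not affect supports. -/
lemma exists_coeff_ne_zero_of_mul {x y : QPDO q} {k : ℤ} (h : (x * y).coeff k ≠ 0) :
    ∃ a b, a + b = k ∧ x.coeff a ≠ 0 ∧ y.coeff b ≠ 0 := by
  rw [eq_sum_mono x, eq_sum_mono y, Finset.sum_mul_sum, ← coeffHom_apply, map_sum] at h
  obtain ⟨a, -, ha⟩ := Finset.exists_ne_zero_of_sum_ne_zero h
  rw [map_sum] at ha
  obtain ⟨b, -, hb⟩ := Finset.exists_ne_zero_of_sum_ne_zero ha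
  rw [mono_mul_mono, coeffHom_apply, coeff_mono] at hb
  refine ⟨a, b, ?_, ?_, ?_⟩
  · by_contra h'
    exact hb (if_neg h')
  · intro h'
    simp [h'] at hb
  · intro h'
    simp [h'] at hb

end QPDO

lemma mem_gradeS {q : ℂˣ} {ε : ℤˣ} {α : HalfInt} {A : SQPDO q} :
    A ∈ gradeS ε α ↔ ∀ (p r : Fin 2) (k : ℤ), (A p r).coeff k ≠ 0 →
      halfDeg ε k (blockDeg p r) = α := by
  refine forall₄_congr fun p r k _ => ?_
  rw [← Subtype.coe_inj, halfDeg_val, blockDeg, eq_comm]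
  push_cast
  rfl

lemma gradeS_one_mem {q : ℂˣ} (ε : ℤˣ) : (1 : SQPDO q) ∈ gradeS ε (0 : HalfInt) := by
  rw [mem_gradeS]
  intro p r k h
  by_cases hpr : p = r
  · subst hpr
    rw [Matrix.one_apply_eq] at h
    have h1 : (1 : QPDO q).coeff k = if 0 = k then (1 : Hol) else 0 := QPDO.coeff_mono 0 k 1
    rw [h1] at h
    have hk : k = 0 := by
      by_contra hk
      exact h (if_neg (Ne.symm hk))
    apply Subtype.ext
    rw [halfDeg_val, hk]
    simp [blockDeg]
  · rw [Matrix.one_apply_ne hpr] at h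
    exact absurd rfl h

lemma halfDeg_add (ε : ℤˣ) (a b d e : ℤ) :
    halfDeg ε a d + halfDeg ε b e = halfDeg ε (a + b) (d + e) := by
  apply Subtype.ext
  rw [AddSubgroup.coe_add, halfDeg_val, halfDeg_val, halfDeg_val]
  push_cast
  ring

lemma blockDeg_add (p l r : Fin 2) : blockDeg p l + blockDeg l r = blockDeg p r := by
  simp only [blockDeg]; ring

lemma gradeS_mul_mem {q : ℂˣ} {ε : ℤˣ} {α β : HalfInt} {x y : SQPDO q}
    (hx : x ∈ gradeS ε α) (hy : y ∈ gradeS ε β) : x * y ∈ gradeS ε (α + β) := by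
  rw [mem_gradeS] at *
  intro p r k h
  rw [Matrix.mul_apply, ← QPDO.coeffHom_apply, map_sum] at h
  obtain ⟨l, -, hl⟩ := Finset.exists_ne_zero_of_sum_ne_zero h
  obtain ⟨a, b, hab, ha, hb⟩ := QPDO.exists_coeff_ne_zero_of_mul hl
  rw [← hx p l a ha, ← hy l r b hb, halfDeg_add, blockDeg_add, hab]

lemma isCoordGrading_gradeS (q : ℂˣ) (ε : ℤˣ) :
    IsCoordGrading (M := SQPDO q) (W := fun _ : Fin 2 × Fin 2 × ℤ => Hol)
      (fun a => (QPDO.coeffHom a.2.2).comp (entryHom (QPDO q) a.1 a.2.1))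
      (fun a => halfDeg ε a.2.2 (blockDeg a.1 a.2.1)) where
  sep x h := by
    ext p r : 2
    exact QPDO.eq_zero_of_coeff fun k => h (p, r, k)
  finite x := by
    classical
    refine ⟨Finset.univ.biUnion fun p : Fin 2 => Finset.univ.biUnion fun r : Fin 2 =>
      (x p r).coeffs.support.image fun k => halfDeg ε k (blockDeg p r), ?_⟩
    rintro ⟨p, r, k⟩ h
    simp only [Finset.mem_biUnion, Finset.mem_univ, true_and, Finset.mem_image]
    exact ⟨p, r, k, Finsupp.mem_support_iff.2 h, rfl⟩
  proj α x := by
    classical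
    refine ⟨fun p r => Finsupp.filter (fun k => halfDeg ε k (blockDeg p r) = α) (x p r).coeffs,
      fun i hi => ?_, fun i hi => ?_⟩
    · exact Finsupp.filter_apply_pos (fun k => halfDeg ε k (blockDeg i.1 i.2.1) = α) _ hi
    · exact Finsupp.filter_apply_neg (fun k => halfDeg ε k (blockDeg i.1 i.2.1) = α) _ hi

lemma parity_zero_iff_coord {q : ℂˣ} (ε : ℤˣ) (x : SQPDO q) : x ∈ parity (QPDO q) 0 ↔
    ∀ a : Fin 2 × Fin 2 × ℤ, (x a.1 a.2.1).coeff a.2.2 ≠ 0 →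
      ∃ n : ℤ, (halfDeg ε a.2.2 (blockDeg a.1 a.2.1) : ℚ) = n := by
  rw [mem_parity]
  constructor
  · rintro h ⟨p, r, k⟩ hk
    have := h p r (fun h' => hk (by rw [h']; rfl))
    rw [halfDeg_int_iff]
    by_contra hpr
    simp [show p ≠ r from hpr] at this
  · intro h p r hpr
    have : ∃ k, (x p r).coeff k ≠ 0 := by
      by_contra! h'
      exact hpr (QPDO.eq_zero_of_coeff h')
    obtain ⟨k, hk⟩ := this
    exact if_pos ((halfDeg_int_iff ε k p r).1 (h (p, r, k) hk))

lemma parity_one_iff_coord {q : ℂˣ} (ε : ℤˣ) (x : SQPDO q) : x ∈ parity (QPDO q) 1 ↔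
    ∀ a : Fin 2 × Fin 2 × ℤ, (x a.1 a.2.1).coeff a.2.2 ≠ 0 →
      ∃ n : ℤ, (halfDeg ε a.2.2 (blockDeg a.1 a.2.1) : ℚ) = n + 1 / 2 := by
  rw [mem_parity]
  constructor
  · rintro h ⟨p, r, k⟩ hk
    have := h p r (fun h' => hk (by rw [h']; rfl))
    rw [halfDeg_half_iff]
    intro hpr
    simp [show p = r from hpr] at this
  · intro h p r hpr
    have : ∃ k, (x p r).coeff k ≠ 0 := by
      by_contra! h'
      exact hpr (QPDO.eq_zero_of_coeff h')
    obtain ⟨k, hk⟩ := this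
    exact if_neg ((halfDeg_half_iff ε k p r).1 (h (p, r, k) hk))

theorem isHalfIntGradedSuperalgebra_SQPDO (q : ℂˣ) (ε : ℤˣ) :
    IsHalfIntGradedSuperalgebra (A := SQPDO q) (gradeS ε) (parity (QPDO q)) where
  parity_gradedMonoid := { one_mem := parity_one_mem _, mul_mem := fun _ _ _ _ => parity_mul_mem }
  parity_internal := (isCoordGrading_parity_single (QPDO q)).isInternal _ fun π x => by
    rw [mem_parity]
    exact ⟨fun h a => h a.1 a.2, fun h p r => h (p, r)⟩
  gradedMonoid := { one_mem := gradeS_one_mem ε, mul_mem := fun _ _ _ _ => gradeS_mul_mem }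
  internal := (isCoordGrading_gradeS q ε).isInternal _ fun α x => by
    rw [mem_gradeS]
    exact ⟨fun h a => h a.1 a.2.1 a.2.2, fun h p r k => h (p, r, k)⟩
  even_eq := (isCoordGrading_gradeS q ε).eq_iSup_of_mem_iff _
    (fun α x => by
      rw [mem_gradeS]
      exact ⟨fun h a => h a.1 a.2.1 a.2.2, fun h p r k => h (p, r, k)⟩) _
    (fun α => ∃ n : ℤ, (α : ℚ) = n) (parity_zero_iff_coord ε)
  odd_eq := (isCoordGrading_gradeS q ε).eq_iSup_of_mem_iff _
    (fun α x => by
      rw [mem_gradeS]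
      exact ⟨fun h a => h a.1 a.2.1 a.2.2, fun h p r k => h (p, r, k)⟩) _
    (fun α => ∃ n : ℤ, (α : ℚ) = n + 1 / 2) (parity_one_iff_coord ε)

/-- Membership in `J` is tested on each coefficient separately, and $0$ passes the test. -/
lemma idealJ_eq_iSup_gradeS {q : ℂˣ} (ε : ℤˣ) (J : Submodule ℂ (SQPDO q)) {n : ℕ}
    (s : Fin n → ℂˣ) (m : Fin n → ℕ) (hJ : J = ⨅ i, idealJ q (s i) (m i)) :
    J = ⨆ α, J ⊓ gradeS ε α := by
  refine (isCoordGrading_gradeS q ε).eq_iSup_inf _ (fun α x => ?_) J fun x hx y hy => ?_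
  · rw [mem_gradeS]
    exact ⟨fun h a => h a.1 a.2.1 a.2.2, fun h p r k => h (p, r, k)⟩
  · rw [hJ, Submodule.mem_iInf] at *
    intro i p r k
    rcases hy (p, r, k) with h | h
    · exact Set.mem_of_eq_of_mem h (hx i p r k)
    · exact Set.mem_of_eq_of_mem h ((0 : idealJ q (s i) (m i)).2 p r k)

lemma idealJ_eq_iSup_parity {q : ℂˣ} (J : Submodule ℂ (SQPDO q)) {n : ℕ}
    (s : Fin n → ℂˣ) (m : Fin n → ℕ) (hJ : J = ⨅ i, idealJ q (s i) (m i)) :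
    J = ⨆ π, J ⊓ parity (QPDO q) π := by
  refine (isCoordGrading_parity_single (QPDO q)).eq_iSup_inf _ (fun π x => ?_) J
    fun x hx y hy => ?_
  · rw [mem_parity]
    exact ⟨fun h a => h a.1 a.2, fun h p r => h (p, r)⟩
  · rw [hJ, Submodule.mem_iInf] at *
    intro i p r k
    rcases hy (p, r) with h | h
    · exact Set.mem_of_eq_of_mem (congrArg (fun z : QPDO q => z.coeff k) h) (hx i p r k)
    · exact Set.mem_of_eq_of_mem (congrArg (fun z : QPDO q => z.coeff k) h)
        ((0 : idealJ q (s i) (m i)).2 p r k)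

/-! ## The gradation of the algebras of infinite matrices -/

lemma mem_gradeM {m : ℕ} {ε : ℤˣ} {α : HalfInt} {A : MInf m} :
    A ∈ gradeM ε α ↔ ∀ (p r : Fin 2) (i j : ℤ), (A p r).1 i j ≠ 0 →
      halfDeg ε (j - i) (blockDeg p r) = α := by
  refine forall₅_congr fun p r i j _ => ?_
  rw [← Subtype.coe_inj, halfDeg_val, blockDeg, pos, pos]
  push_cast
  constructor <;> intro h <;> rw [← h] <;> ring

lemma gradeM_one_mem {m : ℕ} (ε : ℤˣ) : (1 : MInf m) ∈ gradeM ε (0 : HalfInt) := by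
  rw [mem_gradeM]
  intro p r i j h
  by_cases hpr : p = r
  · subst hpr
    rw [Matrix.one_apply_eq, Band.one_val] at h
    have hij : i = j := by
      by_contra hij
      exact h (Matrix.one_apply_ne hij)
    apply Subtype.ext
    rw [halfDeg_val, hij]
    simp [blockDeg]
  · rw [Matrix.one_apply_ne hpr] at h
    exact absurd rfl h

/-- The `(i, j)` entry of an infinite matrix. -/
def Band.entryHom {R : Type} [CommRing R] [Algebra ℂ R] (i j : ℤ) : Band R →+ R where
  toFun a := a.1 i j
  map_zero' := rfl
  map_add' _ _ := rfl

lemma gradeM_mul_mem {m : ℕ} {ε : ℤˣ} {α β : HalfInt} {x y : MInf m}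
    (hx : x ∈ gradeM ε α) (hy : y ∈ gradeM ε β) : x * y ∈ gradeM ε (α + β) := by
  rw [mem_gradeM] at *
  intro p r i j h
  have h' : Band.entryHom i j ((x * y) p r) ≠ 0 := h
  rw [Matrix.mul_apply, map_sum] at h'
  obtain ⟨l, -, hl⟩ := Finset.exists_ne_zero_of_sum_ne_zero h'
  have h2 : ∃ k, (x p l).1 i k * (y l r).1 k j ≠ 0 := by
    by_contra! h2
    exact hl ((finsum_congr h2).trans finsum_zero)
  obtain ⟨k, hk⟩ := h2
  rw [← hx p l i k (left_ne_zero_of_mul hk), ← hy l r k j (right_ne_zero_of_mul hk), halfDeg_add,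
    blockDeg_add, show k - i + (j - k) = j - i by ring]

/-- An element may have infinitely many nonzero entries, but the degree depends only on the block
and on $j-i$, which the band condition bounds. -/
lemma isCoordGrading_gradeM {n : ℕ} (m : Fin n → ℕ) (ε : ℤˣ) :
    IsCoordGrading (M := (i : Fin n) → MInf (m i))
      (W := fun a : Fin n × Fin 2 × Fin 2 × ℤ × ℤ => TruncPoly (m a.1))
      (fun a => ((Band.entryHom a.2.2.2.1 a.2.2.2.2).comp (entryHom _ a.2.1 a.2.2.1)).comp
        (Pi.evalAddMonoidHom _ a.1))
      (fun a => halfDeg ε (a.2.2.2.2 - a.2.2.2.1) (blockDeg a.2.1 a.2.2.1)) where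
  sep x h := by
    funext l
    ext p r i j : 4
    exact h (l, p, r, i, j)
  finite x := by
    classical
    choose N hN using fun l p r => (x l p r).2
    refine ⟨Finset.univ.biUnion fun l : Fin n => Finset.univ.biUnion fun p : Fin 2 =>
      Finset.univ.biUnion fun r : Fin 2 => (Finset.Icc (-(N l p r : ℤ)) (N l p r)).image
        fun k => halfDeg ε k (blockDeg p r), ?_⟩
    rintro ⟨l, p, r, i, j⟩ h
    simp only [Finset.mem_biUnion, Finset.mem_univ, true_and, Finset.mem_image]
    refine ⟨l, p, r, j - i, ?_, rfl⟩
    rw [Finset.mem_Icc, ← abs_le]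
    by_contra h'
    rw [not_le, abs_sub_comm] at h'
    exact h (hN l p r i j h')
  proj α x := by
    classical
    refine ⟨fun l p r => ⟨fun i j => if halfDeg ε (j - i) (blockDeg p r) = α then (x l p r).1 i j
      else 0, ?_⟩, fun i hi => ?_, fun i hi => ?_⟩
    · obtain ⟨N, hN⟩ := (x l p r).2
      refine ⟨N, fun i j h => ?_⟩
      change ite _ _ _ = _
      rw [hN i j h, ite_self]
    · exact if_pos hi
    · exact if_neg hi

lemma Band.exists_ne_zero {R : Type} [CommRing R] [Algebra ℂ R] {a : Band R} (h : a ≠ 0) :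
    ∃ i j, a.1 i j ≠ 0 := by
  by_contra! h'
  exact h (Subtype.ext (by ext i j; exact h' i j))

lemma mem_pi_gradeM {n : ℕ} (m : Fin n → ℕ) (ε : ℤˣ) (α : HalfInt)
    (x : (i : Fin n) → MInf (m i)) :
    x ∈ (Submodule.pi Set.univ fun i => gradeM (m := m i) ε α) ↔
      ∀ a : Fin n × Fin 2 × Fin 2 × ℤ × ℤ, (x a.1 a.2.1 a.2.2.1).1 a.2.2.2.1 a.2.2.2.2 ≠ 0 →
        halfDeg ε (a.2.2.2.2 - a.2.2.2.1) (blockDeg a.2.1 a.2.2.1) = α := by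
  simp only [Submodule.mem_pi, Set.mem_univ, true_imp_iff, mem_gradeM]
  exact ⟨fun h a => h a.1 a.2.1 a.2.2.1 a.2.2.2.1 a.2.2.2.2, fun h l p r i j => h (l, p, r, i, j)⟩

lemma mem_pi_parity_iff_coord {n : ℕ} (m : Fin n → ℕ) (Q : HalfInt → Prop) (ε : ℤˣ) (π : ZMod 2)
    (hQ : ∀ k p r, Q (halfDeg ε k (blockDeg p r)) ↔ (if p = r then 0 else 1 : ZMod 2) = π)
    (x : (i : Fin n) → MInf (m i)) :
    x ∈ (Submodule.pi Set.univ fun i => parity (Band (TruncPoly (m i))) π) ↔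
      ∀ a : Fin n × Fin 2 × Fin 2 × ℤ × ℤ, (x a.1 a.2.1 a.2.2.1).1 a.2.2.2.1 a.2.2.2.2 ≠ 0 →
        Q (halfDeg ε (a.2.2.2.2 - a.2.2.2.1) (blockDeg a.2.1 a.2.2.1)) := by
  simp only [Submodule.mem_pi, Set.mem_univ, true_imp_iff, mem_parity, hQ]
  constructor
  · rintro h ⟨l, p, r, i, j⟩ hne
    exact h l p r (fun h' => hne (by rw [h']; rfl))
  · intro h l p r hne
    obtain ⟨i, j, hij⟩ := Band.exists_ne_zero hne
    exact h (l, p, r, i, j) hij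

theorem isHalfIntGradedSuperalgebra_MInf {n : ℕ} (m : Fin n → ℕ) (ε : ℤˣ) :
    IsHalfIntGradedSuperalgebra (A := (i : Fin n) → MInf (m i))
      (fun α => Submodule.pi Set.univ fun _ => gradeM ε α)
      (fun π => Submodule.pi Set.univ fun i => parity (Band (TruncPoly (m i))) π) where
  parity_gradedMonoid :=
    { one_mem := fun i _ => parity_one_mem _
      mul_mem := fun _ _ _ _ hx hy i hi => parity_mul_mem (hx i hi) (hy i hi) }
  parity_internal := (isCoordGrading_parity fun i => Band (TruncPoly (m i))).isInternal _
    fun π x => by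
      simp only [Submodule.mem_pi, Set.mem_univ, true_imp_iff, mem_parity]
      exact ⟨fun h a => h a.1 a.2.1 a.2.2, fun h l p r => h (l, p, r)⟩
  gradedMonoid :=
    { one_mem := fun i _ => gradeM_one_mem ε
      mul_mem := fun _ _ _ _ hx hy i hi => gradeM_mul_mem (hx i hi) (hy i hi) }
  internal := (isCoordGrading_gradeM m ε).isInternal _ (mem_pi_gradeM m ε)
  even_eq := (isCoordGrading_gradeM m ε).eq_iSup_of_mem_iff _ (mem_pi_gradeM m ε) _
    (fun α => ∃ n : ℤ, (α : ℚ) = n) (mem_pi_parity_iff_coord m (fun α => ∃ n : ℤ, (α : ℚ) = n) ε 0 fun k p r => by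
      rw [halfDeg_int_iff]; split_ifs with h <;> simp [h])
  odd_eq := (isCoordGrading_gradeM m ε).eq_iSup_of_mem_iff _ (mem_pi_gradeM m ε) _
    (fun α => ∃ n : ℤ, (α : ℚ) = n + 1 / 2) (mem_pi_parity_iff_coord m (fun α => ∃ n : ℤ, (α : ℚ) = n + 1 / 2) ε 1 fun k p r => by
      rw [halfDeg_half_iff]; split_ifs with h <;> simp [h])

/-! ## Jets -/

/-- The function `t ↦ f(u qᵗ)`. -/
def orbitFun (logq : ℂ) (u : ℂˣ) (f : Hol) (t : ℂ) : ℂ := f.1 (u * expU (t * logq))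

/-- The Taylor polynomial of degree `m` of `t ↦ f(u qᵗ)`. -/
def taylorPoly (logq : ℂ) (m : ℕ) (u : ℂˣ) (f : Hol) : ℂ[X] :=
  ∑ i ∈ Finset.range (m + 1),
    C (iteratedDeriv i (orbitFun logq u f) 0 / (i.factorial : ℂ)) * X ^ i

section jets

variable (logq : ℂ) (m : ℕ) (u : ℂˣ)

lemma jet_eq_mk (f : Hol) :
    jet logq m u f = Ideal.Quotient.mk _ (taylorPoly logq m u f) := rfl

lemma coeff_taylorPoly (f : Hol) {d : ℕ} (hd : d < m + 1) :
    (taylorPoly logq m u f).coeff d =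
      iteratedDeriv d (orbitFun logq u f) 0 / (d.factorial : ℂ) := by
  rw [taylorPoly, finsetSum_coeff, Finset.sum_eq_single d]
  · simp
  · intro b _ hb
    simp [coeff_X_pow, hb.symm]
  · intro h
    exact absurd (Finset.mem_range.2 hd) h

lemma mk_eq_mk_iff {m : ℕ} (P Q : ℂ[X]) :
    (Ideal.Quotient.mk (Ideal.span {(X : ℂ[X]) ^ (m + 1)}) P = Ideal.Quotient.mk _ Q) ↔
      ∀ d < m + 1, P.coeff d = Q.coeff d := by
  rw [Ideal.Quotient.mk_eq_mk_iff_sub_mem, Ideal.mem_span_singleton, X_pow_dvd_iff]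
  simp only [coeff_sub, sub_eq_zero]

lemma orbitFun_eq (f : Hol) :
    orbitFun logq u f = ext0 f.1 ∘ fun t : ℂ => (u : ℂ) * Complex.exp (t * logq) := by
  funext t
  exact (ext0_val f.1 _).symm

lemma analyticAt_ext0 (f : Hol) : AnalyticAt ℂ (ext0 f.1) (u : ℂ) := by
  have h : DifferentiableOn ℂ (ext0 f.1) {0}ᶜ := fun z hz => by
    lift z to ℂˣ using IsUnit.mk0 z hz
    exact (f.2 z).differentiableWithinAt
  exact h.analyticAt (isOpen_compl_singleton.mem_nhds u.ne_zero)

lemma analyticAt_orbitFun (f : Hol) : AnalyticAt ℂ (orbitFun logq u f) 0 := by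
  rw [orbitFun_eq]
  refine AnalyticAt.comp ?_ (by fun_prop)
  simpa using analyticAt_ext0 u f

lemma contDiffAt_orbitFun (f : Hol) (i : ℕ) : ContDiffAt ℂ i (orbitFun logq u f) 0 :=
  (analyticAt_orbitFun logq u f).contDiffAt

lemma jet_add (f g : Hol) : jet logq m u (f + g) = jet logq m u f + jet logq m u g := by
  simp only [jet_eq_mk, ← map_add]
  rw [mk_eq_mk_iff]
  intro d hd
  rw [coeff_add, coeff_taylorPoly _ _ _ _ hd, coeff_taylorPoly _ _ _ _ hd,
    coeff_taylorPoly _ _ _ _ hd, ← add_div]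
  congr 1
  exact iteratedDeriv_add (contDiffAt_orbitFun _ _ _ _) (contDiffAt_orbitFun _ _ _ _)

lemma jet_algebraMap (c : ℂ) : jet logq m u (algebraMap ℂ Hol c) = algebraMap ℂ _ c := by
  have h : algebraMap ℂ (TruncPoly m) c = Ideal.Quotient.mk _ (C c) := rfl
  rw [jet_eq_mk, h, mk_eq_mk_iff]
  intro d hd
  have h1 : orbitFun logq u (algebraMap ℂ Hol c) = fun _ => c := rfl
  rw [coeff_taylorPoly _ _ _ _ hd, h1, iteratedDeriv_const, coeff_C]
  split_ifs with h0
  · simp [h0]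
  · simp

/-- Divided by $d!$, the Leibniz rule is the Cauchy product, because $\binom di/d!=1/(i!\,(d-i)!)$.
-/
lemma jet_mul (f g : Hol) : jet logq m u (f * g) = jet logq m u f * jet logq m u g := by
  simp only [jet_eq_mk, ← map_mul]
  rw [mk_eq_mk_iff]
  intro d hd
  have h1 : orbitFun logq u (f * g) = orbitFun logq u f * orbitFun logq u g := rfl
  rw [coeff_taylorPoly _ _ _ _ hd, h1,
    iteratedDeriv_mul (contDiffAt_orbitFun _ _ _ _) (contDiffAt_orbitFun _ _ _ _), coeff_mul,
    Finset.Nat.sum_antidiagonal_eq_sum_range_succ_mk, Finset.sum_div]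
  refine Finset.sum_congr rfl fun i hi => ?_
  have hi' : i ≤ d := Nat.lt_succ_iff.1 (Finset.mem_range.1 hi)
  rw [coeff_taylorPoly _ _ _ _ (by omega), coeff_taylorPoly _ _ _ _ (by omega),
    Nat.cast_choose ℂ hi']
  have h2 : (d.factorial : ℂ) ≠ 0 := by exact_mod_cast d.factorial_ne_zero
  field_simp

/-- Jets as an algebra homomorphism. -/
def jetHom : Hol →ₐ[ℂ] TruncPoly m where
  toFun := jet logq m u
  map_one' := by rw [← map_one (algebraMap ℂ Hol), jet_algebraMap, map_one]
  map_mul' := jet_mul logq m u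
  map_zero' := jet_zero logq m u
  map_add' := jet_add logq m u
  commutes' := jet_algebraMap logq m u

lemma jetHom_apply (f : Hol) : jetHom logq m u f = jet logq m u f := rfl

/-- The jet has no constant term, so it is a multiple of $t$. This serves for $X-u$ and, in the
corrections, for $1-e^N$. -/
lemma jetHom_pow_eq_zero {f : Hol} (hf : f.1 u = 0) : jetHom logq m u f ^ (m + 1) = 0 := by
  rw [jetHom_apply, jet_eq_mk, ← map_pow, Ideal.Quotient.eq_zero_iff_mem,
    Ideal.mem_span_singleton]
  refine pow_dvd_pow_of_dvd (X_dvd_iff.2 ?_) _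
  rw [coeff_taylorPoly _ _ _ _ (by omega)]
  simp [orbitFun, expU, hf]

variable {logq}

/-- The derivative of $t\mapsto uq^t$ at $0$ is $u\log q\ne0$, so composition with it preserves the
order of vanishing. -/
lemma jetHom_eq_zero_iff (hq : logq ≠ 0) (f : Hol) :
    jetHom logq m u f = 0 ↔ ∀ i ≤ m, iteratedDeriv i (ext0 f.1) (u : ℂ) = 0 := by
  have h1 : analyticOrderAt (orbitFun logq u f) 0 = analyticOrderAt (ext0 f.1) (u : ℂ) := by
    have hg : AnalyticAt ℂ (fun t : ℂ => (u : ℂ) * Complex.exp (t * logq)) 0 := by fun_prop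
    have hd : HasDerivAt (fun t : ℂ => (u : ℂ) * Complex.exp (t * logq))
        ((u : ℂ) * (Complex.exp (0 * logq) * (1 * logq))) 0 :=
      (((hasDerivAt_id (0 : ℂ)).mul_const logq).cexp).const_mul (u : ℂ)
    rw [orbitFun_eq, analyticOrderAt_comp_of_deriv_ne_zero hg]
    · simp
    · rw [hd.deriv]
      simp [hq]
  have h2 := natCast_le_analyticOrderAt_iff_iteratedDeriv_eq_zero (n := m + 1)
    (analyticAt_orbitFun logq u f)
  rw [h1, natCast_le_analyticOrderAt_iff_iteratedDeriv_eq_zero (analyticAt_ext0 u f)] at h2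
  simp only [Nat.lt_succ_iff] at h2
  rw [h2, jetHom_apply, jet_eq_mk, ← map_zero (Ideal.Quotient.mk _), mk_eq_mk_iff]
  refine ⟨fun h i hi => ?_, fun h i hi => ?_⟩
  · have h3 := h i (by omega)
    rw [coeff_taylorPoly _ _ _ _ (by omega), coeff_zero] at h3
    exact (div_eq_zero_iff.1 h3).resolve_right (by exact_mod_cast i.factorial_ne_zero)
  · rw [coeff_taylorPoly _ _ _ _ hi, h i (by omega), zero_div, coeff_zero]

end jets

/-! ## Polynomials -/

/-- The restriction to `ℂˣ` of a function that is differentiable away from `0`. -/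
def Hol.restrict (F : ℂ → ℂ) (hF : DifferentiableOn ℂ F {0}ᶜ) : Hol :=
  ⟨fun u => F u, fun u => by
    have h : ext0 (fun u : ℂˣ => F u) =ᶠ[nhds (u : ℂ)] F := by
      filter_upwards [isOpen_ne.mem_nhds u.ne_zero] with z hz
      lift z to ℂˣ using IsUnit.mk0 z hz
      simp [ext0_val]
    exact (hF.differentiableAt (isOpen_compl_singleton.mem_nhds u.ne_zero)).congr_of_eventuallyEq h⟩

lemma Hol.restrict_apply (F : ℂ → ℂ) (hF : DifferentiableOn ℂ F {0}ᶜ) (u : ℂˣ) :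
    (Hol.restrict F hF).1 u = F u := rfl

/-- Polynomials as holomorphic functions on `ℂˣ`. -/
def polyHol : ℂ[X] →ₐ[ℂ] Hol := aeval (Hol.restrict (fun z => z) differentiableOn_id)

lemma polyHol_apply (P : ℂ[X]) (u : ℂˣ) : (polyHol P).1 u = P.eval (u : ℂ) := by
  have h := aeval_algHom_apply ((Pi.evalAlgHom ℂ (fun _ : ℂˣ => ℂ) u).comp Hol.val)
    (Hol.restrict (fun z => z) differentiableOn_id) P
  rw [← coe_aeval_eq_eval]
  exact h.symm

section polynomials

variable {logq : ℂ} (m : ℕ) (u : ℂˣ)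

lemma jetHom_polyHol_eq_zero {P : ℂ[X]} (h : (X - C (u : ℂ)) ^ (m + 1) ∣ P) :
    jetHom logq m u (polyHol P) = 0 := by
  obtain ⟨Q, rfl⟩ := h
  rw [map_mul, map_mul, map_pow, map_pow, jetHom_pow_eq_zero, zero_mul]
  rw [polyHol_apply]
  simp

/-- For a nonzero polynomial the analytic order of vanishing at $u$ is the root multiplicity. -/
lemma dvd_of_jetHom_polyHol_eq_zero (hq : logq ≠ 0) {P : ℂ[X]}
    (h : jetHom logq m u (polyHol P) = 0) : (X - C (u : ℂ)) ^ (m + 1) ∣ P := by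
  by_cases hP : P = 0
  · rw [hP]
    exact dvd_zero _
  rw [jetHom_eq_zero_iff m u hq] at h
  have h1 : ext0 (polyHol P).1 =ᶠ[nhds (u : ℂ)] fun z => P.eval z := by
    filter_upwards [isOpen_ne.mem_nhds u.ne_zero] with z hz
    lift z to ℂˣ using IsUnit.mk0 z hz
    rw [ext0_val, polyHol_apply]
  have h2 : ((m + 1 : ℕ) : ℕ∞) ≤ analyticOrderAt (ext0 (polyHol P).1) (u : ℂ) := by
    rw [natCast_le_analyticOrderAt_iff_iteratedDeriv_eq_zero (analyticAt_ext0 u _)]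
    exact fun i hi => h i (by omega)
  obtain ⟨Q, hPQ, hQ⟩ := exists_eq_pow_rootMultiplicity_mul_and_not_dvd P hP (u : ℂ)
  have h3 : analyticOrderAt (fun z : ℂ => P.eval z) (u : ℂ) = (P.rootMultiplicity (u : ℂ) : ℕ) := by
    rw [AnalyticAt.analyticOrderAt_eq_natCast (AnalyticOnNhd.eval_polynomial P _ (Set.mem_univ _))]
    refine ⟨fun z => Q.eval z, AnalyticOnNhd.eval_polynomial Q _ (Set.mem_univ _), ?_, ?_⟩
    · rwa [dvd_iff_isRoot] at hQ
    · refine Filter.Eventually.of_forall fun z => ?_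
      conv_lhs => rw [hPQ]
      simp
  rw [analyticOrderAt_congr h1, h3, Nat.cast_le] at h2
  exact (pow_dvd_pow _ h2).trans (pow_rootMultiplicity_dvd P _)

/-- The jet map is injective on $\mathbb C[X]/(X-u)^{m+1}$, whose dimension $m+1$ is that of $R_m$;
so it is onto. -/
lemma exists_jetHom_polyHol_eq (hq : logq ≠ 0) (r : TruncPoly m) :
    ∃ P : ℂ[X], jetHom logq m u (polyHol P) = r := by
  let I : Ideal ℂ[X] := Ideal.span {(X - C (u : ℂ)) ^ (m + 1)}
  let ψ : (ℂ[X] ⧸ I) →ₐ[ℂ] TruncPoly m := Ideal.Quotient.liftₐ I ((jetHom logq m u).comp polyHol)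
    fun P hP => jetHom_polyHol_eq_zero m u (Ideal.mem_span_singleton.1 hP)
  have hinj : Function.Injective ψ.toLinearMap := by
    rw [← LinearMap.ker_eq_bot, LinearMap.ker_eq_bot']
    intro x hx
    obtain ⟨P, rfl⟩ := Ideal.Quotient.mk_surjective x
    exact Ideal.Quotient.eq_zero_iff_mem.2
      (Ideal.mem_span_singleton.2 (dvd_of_jetHom_polyHol_eq_zero m u hq hx))
  have hd1 : Module.finrank ℂ (ℂ[X] ⧸ I) = m + 1 := by
    rw [finrank_quotient_span_eq_natDegree, natDegree_pow, natDegree_X_sub_C, mul_one]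
  have hd2 : Module.finrank ℂ (TruncPoly m) = m + 1 := by
    rw [finrank_quotient_span_eq_natDegree, natDegree_X_pow]
  have : FiniteDimensional ℂ (ℂ[X] ⧸ I) := FiniteDimensional.of_finrank_pos (by omega)
  have : FiniteDimensional ℂ (TruncPoly m) := FiniteDimensional.of_finrank_pos (by omega)
  obtain ⟨x, hx⟩ :=
    (LinearMap.injective_iff_surjective_of_finrank_eq_finrank (hd1.trans hd2.symm)).1 hinj r
  obtain ⟨P, rfl⟩ := Ideal.Quotient.mk_surjective x
  exact ⟨P, hx⟩

end polynomials

/-- Polynomial interpolation of a jet at `p k`, with a high order of vanishing at the points `p l`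
for `l < k`. -/
lemma exists_polyHol_interpolation {logq : ℂ} (hq : logq ≠ 0) {p : ℕ → ℂˣ}
    (hp : Function.Injective p) (m : ℕ → ℕ) (k : ℕ) (r : TruncPoly (m k)) :
    ∃ P : ℂ[X], jetHom logq (m k) (p k) (polyHol P) = r ∧
      ∀ l < k, jetHom logq (m l) (p l) (polyHol P) = 0 := by
  set D : ℂ[X] := ∏ l ∈ Finset.range k, (X - C (p l : ℂ)) ^ (m l + 1) with hD
  have hcop : IsCoprime D ((X - C (p k : ℂ)) ^ (m k + 1)) := by
    refine IsCoprime.prod_left fun l hl => IsCoprime.pow ?_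
    refine isCoprime_X_sub_C_of_isUnit_sub (IsUnit.mk0 _ (sub_ne_zero.2 fun h => ?_))
    exact (Finset.mem_range.1 hl).ne (hp (Units.ext h))
  -- By Bézout $AD\equiv1$ modulo $(X-p_k)^{m_k+1}$, so $ADR$ keeps the jet of $R$ at $p_k$ while
  -- $D$ supplies the zeros at the earlier points.
  obtain ⟨A, B, hAB⟩ := hcop
  obtain ⟨R, hR⟩ := exists_jetHom_polyHol_eq (m k) (p k) hq r
  refine ⟨A * D * R, ?_, fun l hl => jetHom_polyHol_eq_zero _ _ ?_⟩
  · have h1 : A * D = 1 - B * (X - C (p k : ℂ)) ^ (m k + 1) := eq_sub_of_add_eq hAB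
    rw [map_mul, map_mul, hR, h1, map_sub, map_sub, map_one, map_one,
      jetHom_polyHol_eq_zero _ _ (dvd_mul_left _ B), sub_zero, one_mul]
  · exact ((Finset.dvd_prod_of_mem (fun l => (X - C (p l : ℂ)) ^ (m l + 1))
      (Finset.mem_range.2 hl)).trans (dvd_mul_left D A)).trans (dvd_mul_right _ R)

/-! ## Interpolation of jets at infinitely many points -/

lemma ext0_coe_sub (f g : Hol) : ext0 (f - g : Hol).1 = ext0 f.1 - ext0 g.1 := by
  rw [sub_eq_add_neg, ← neg_one_smul ℂ g, ext0_coe_add, ext0_coe_smul, neg_one_smul,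
    ← sub_eq_add_neg]

lemma jetHom_eq_iff {logq : ℂ} (hq : logq ≠ 0) (m : ℕ) (u : ℂˣ) (f g : Hol) :
    jetHom logq m u f = jetHom logq m u g ↔
      ∀ i ≤ m, iteratedDeriv i (ext0 f.1) (u : ℂ) = iteratedDeriv i (ext0 g.1) (u : ℂ) := by
  rw [← sub_eq_zero, ← map_sub, jetHom_eq_zero_iff m u hq]
  refine forall₂_congr fun i _ => ?_
  rw [ext0_coe_sub, iteratedDeriv_sub (contDiffAt_ext0 _ _ _) (contDiffAt_ext0 _ _ _), sub_eq_zero]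

lemma norm_coe_eq_exp (u : ℂˣ) : ‖(u : ℂ)‖ = Real.exp (Real.log ‖(u : ℂ)‖) :=
  (Real.exp_log (norm_pos_iff.2 u.ne_zero)).symm

/-- Take $e=z/p$ if $|p|\ge1$ and $e=p/z$ if $|p|\le1$: the annulus is one logarithmic unit away
from $p$ on the side of the unit circle. -/
lemma exists_hol_one_and_small (p : ℂˣ) : ∃ e : Hol, e.1 p = 1 ∧
    ∀ w : ℂˣ, |Real.log ‖(w : ℂ)‖| ≤ |Real.log ‖(p : ℂ)‖| - 1 → ‖e.1 w‖ ≤ Real.exp (-1) := by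
  rcases le_total 0 (Real.log ‖(p : ℂ)‖) with h | h
  · refine ⟨Hol.restrict (fun z => z / p) (by fun_prop), div_self p.ne_zero, fun w hw => ?_⟩
    rw [Hol.restrict_apply, norm_div, norm_coe_eq_exp w, norm_coe_eq_exp p, ← Real.exp_sub,
      Real.exp_le_exp]
    rw [abs_of_nonneg h] at hw
    linarith [le_abs_self (Real.log ‖(w : ℂ)‖)]
  · refine ⟨Hol.restrict (fun z => p / z) (DifferentiableOn.div (by fun_prop) (by fun_prop)
      fun z hz => hz), div_self p.ne_zero, fun w hw => ?_⟩
    rw [Hol.restrict_apply, norm_div, norm_coe_eq_exp w, norm_coe_eq_exp p, ← Real.exp_sub,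
      Real.exp_le_exp]
    rw [abs_of_nonpos h] at hw
    linarith [neg_abs_le (Real.log ‖(w : ℂ)‖)]

/-- The interpolating polynomial is multiplied by $1-(1-e^N)^{m_k+1}$. This factor has jet $1$ at
$p_k$, because $1-e^N$ vanishes there, and it tends to $0$ uniformly on the annulus as $N\to\infty$.
-/
lemma exists_small_correction {logq : ℂ} (hq : logq ≠ 0) {p : ℕ → ℂˣ}
    (hp : Function.Injective p) (m : ℕ → ℕ) (k : ℕ) (r : TruncPoly (m k)) {δ : ℝ} (hδ : 0 < δ) :
    ∃ g : Hol, jetHom logq (m k) (p k) g = r ∧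
      (∀ l < k, jetHom logq (m l) (p l) g = 0) ∧
      ∀ w : ℂˣ, |Real.log ‖(w : ℂ)‖| ≤ |Real.log ‖(p k : ℂ)‖| - 1 → ‖g.1 w‖ ≤ δ := by
  obtain ⟨P, hP, hP0⟩ := exists_polyHol_interpolation hq hp m k r
  obtain ⟨e, he, hsmall⟩ := exists_hol_one_and_small (p k)
  -- This disc contains the annulus, so $P$ is bounded there independently of $N$.
  obtain ⟨B, hB⟩ := (isCompact_closedBall (0 : ℂ)
    (Real.exp |Real.log ‖(p k : ℂ)‖|)).exists_bound_of_continuousOn P.continuous.continuousOn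
  have hcont : ContinuousAt (fun y : ℂ => 1 - (1 - y) ^ (m k + 1)) 0 := by fun_prop
  obtain ⟨η, hη, hη'⟩ := Metric.continuousAt_iff.1 hcont (δ / (|B| + 1)) (by positivity)
  obtain ⟨N, hN⟩ := exists_pow_lt_of_lt_one hη (Real.exp_lt_one_iff.2 (by norm_num : (-1 : ℝ) < 0))
  refine ⟨polyHol P * (1 - (1 - e ^ N) ^ (m k + 1)), ?_, fun l hl => ?_, fun w hw => ?_⟩
  · rw [map_mul, hP, map_sub, map_pow, jetHom_pow_eq_zero, map_one, sub_zero, mul_one]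
    change 1 - e.1 (p k) ^ N = 0
    rw [he, one_pow, sub_self]
  · rw [map_mul, hP0 l hl, zero_mul]
  · change ‖(polyHol P).1 w * (1 - (1 - e.1 w ^ N) ^ (m k + 1))‖ ≤ δ
    have h1 : ‖(polyHol P).1 w‖ ≤ |B| := by
      rw [polyHol_apply]
      refine (hB w ?_).trans (le_abs_self B)
      rw [mem_closedBall_zero_iff, norm_coe_eq_exp w, Real.exp_le_exp]
      linarith [le_abs_self (Real.log ‖(w : ℂ)‖)]
    have h2 : ‖1 - (1 - e.1 w ^ N) ^ (m k + 1)‖ < δ / (|B| + 1) := by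
      have h3 := @hη' (e.1 w ^ N) (by
        rw [dist_zero_right, norm_pow]
        exact (pow_le_pow_left₀ (norm_nonneg _) (hsmall w hw) N).trans_lt hN)
      simpa [dist_eq_norm] using h3
    rw [norm_mul]
    calc ‖(polyHol P).1 w‖ * ‖1 - (1 - e.1 w ^ N) ^ (m k + 1)‖
        ≤ (|B| + 1) * (δ / (|B| + 1)) := by gcongr; linarith
      _ = δ := by field_simp

/-! ### Locally uniform limits and their derivatives -/

lemma differentiableOn_iteratedDeriv {U : Set ℂ} (hU : IsOpen U) {f : ℂ → ℂ}
    (hf : DifferentiableOn ℂ f U) (i : ℕ) : DifferentiableOn ℂ (iteratedDeriv i f) U := by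
  induction i with
  | zero => simpa using hf
  | succ i ih =>
    rw [iteratedDeriv_succ]
    exact ih.deriv hU

lemma tendstoLocallyUniformlyOn_iteratedDeriv {U : Set ℂ} (hU : IsOpen U) {T : ℕ → ℂ → ℂ}
    {F : ℂ → ℂ} (h : TendstoLocallyUniformlyOn T F Filter.atTop U)
    (hT : ∀ n, DifferentiableOn ℂ (T n) U) (i : ℕ) :
    TendstoLocallyUniformlyOn (fun n => iteratedDeriv i (T n)) (iteratedDeriv i F)
      Filter.atTop U := by
  induction i with
  | zero => simpa using h
  | succ i ih =>
    simp only [iteratedDeriv_succ]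
    exact ih.deriv (Filter.Eventually.of_forall fun n =>
      differentiableOn_iteratedDeriv hU (hT n) i) hU

lemma differentiableOn_ext0 (f : Hol) : DifferentiableOn ℂ (ext0 f.1) {0}ᶜ := fun z hz => by
  lift z to ℂˣ using IsUnit.mk0 z hz
  exact (f.2 z).differentiableWithinAt

lemma ext0_coe_sum (G : ℕ → Hol) (N : ℕ) (z : ℂ) :
    ext0 (∑ k ∈ Finset.range N, G k : Hol).1 z = ∑ k ∈ Finset.range N, ext0 (G k).1 z := by
  induction N with
  | zero => simp only [Finset.range_zero, Finset.sum_empty, ext0_coe_zero]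
  | succ N ih => rw [Finset.sum_range_succ, Finset.sum_range_succ, ext0_coe_add, Pi.add_apply, ih]

/-- On a compact subset of $\mathbb C^\times$ the function $|\log|z||$ is bounded, so all but
finitely many terms are at most $2^{-k}$ there, and the Weierstrass M-test applies. -/
lemma exists_tendstoLocallyUniformlyOn_sum {b : ℕ → ℝ}
    (hb : Filter.Tendsto b Filter.atTop Filter.atTop)
    (G : ℕ → Hol) (hG : ∀ k, ∀ w : ℂˣ, |Real.log ‖(w : ℂ)‖| ≤ b k - 1 →
      ‖(G k).1 w‖ ≤ (1 / 2) ^ k) :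
    ∃ f : Hol, TendstoLocallyUniformlyOn (fun N => ext0 (∑ k ∈ Finset.range N, G k : Hol).1)
      (ext0 f.1) Filter.atTop {0}ᶜ := by
  have hopen : IsOpen ({0}ᶜ : Set ℂ) := isOpen_compl_singleton
  have key : TendstoLocallyUniformlyOn (fun N => ext0 (∑ k ∈ Finset.range N, G k : Hol).1)
      (fun z => ∑' k, ext0 (G k).1 z) Filter.atTop {0}ᶜ := by
    rw [tendstoLocallyUniformlyOn_iff_forall_isCompact hopen]
    intro K hK hKc
    have hlog : ContinuousOn (fun z : ℂ => Real.log ‖z‖) K :=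
      ContinuousOn.log (by fun_prop) fun z hz => norm_ne_zero_iff.2 (hK hz)
    obtain ⟨B, hB⟩ := hKc.exists_bound_of_continuousOn hlog
    have h := tendstoUniformlyOn_tsum_nat_eventually (f := fun k z => ext0 (G k).1 z) (s := K)
      summable_geometric_two (by
        filter_upwards [hb.eventually_ge_atTop (B + 1)] with k hk z hz
        have hz0 : z ≠ 0 := hK hz
        have hBz := hB z hz
        lift z to ℂˣ using IsUnit.mk0 z hz0
        rw [ext0_val]
        refine hG k z ?_
        rw [Real.norm_eq_abs] at hBz
        linarith)
    exact h.congr (Filter.Eventually.of_forall fun N z _ => (ext0_coe_sum G N z).symm)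
  have hdiff : DifferentiableOn ℂ (fun z => ∑' k, ext0 (G k).1 z) {0}ᶜ :=
    key.differentiableOn (Filter.Eventually.of_forall fun N => differentiableOn_ext0 _) hopen
  refine ⟨Hol.restrict _ hdiff, key.congr_right fun z hz => ?_⟩
  lift z to ℂˣ using IsUnit.mk0 z hz
  exact (ext0_val (Hol.restrict _ hdiff).1 z).symm

/-- Holomorphic functions on `ℂˣ` with prescribed jets at the points of a sequence that
accumulates only at `0` and `∞`. -/
theorem exists_hol_jetHom_eq {logq : ℂ} (hq : logq ≠ 0) {p : ℕ → ℂˣ} (hp : Function.Injective p)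
    (hlim : Filter.Tendsto (fun k => |Real.log ‖(p k : ℂ)‖|) Filter.atTop Filter.atTop)
    (m : ℕ → ℕ) (r : ∀ k, TruncPoly (m k)) :
    ∃ f : Hol, ∀ k, jetHom logq (m k) (p k) f = r k := by
  -- The correction depends on the partial sum `S` so far: its jet at $p_k$ is the defect of `S`.
  choose g hg hg0 hsmall using fun (k : ℕ) (S : Hol) =>
    exists_small_correction hq hp m k (r k - jetHom logq (m k) (p k) S)
      (δ := (1 / 2) ^ k) (by positivity)
  let S : ℕ → Hol := fun N => Nat.rec 0 (fun k S => S + g k S) N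
  have hS : ∀ N, S (N + 1) = S N + g N (S N) := fun N => rfl
  have hsum : ∀ N, S N = ∑ k ∈ Finset.range N, g k (S k) := by
    intro N
    induction N with
    | zero => rfl
    | succ N ih => rw [Finset.sum_range_succ, hS, ← ih]
  obtain ⟨f, hf⟩ := exists_tendstoLocallyUniformlyOn_sum hlim (fun k => g k (S k))
    fun k w hw => hsmall k (S k) w hw
  simp only [← hsum] at hf
  -- `S N` contains the corrections with index below `N`; from `l + 1` on, the jet at $p_l$ is right
  -- and later corrections leave it unchanged.
  have hjet : ∀ l d, jetHom logq (m l) (p l) (S (l + 1 + d)) = r l := by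
    intro l d
    induction d with
    | zero => rw [add_zero, hS, map_add, hg, add_sub_cancel]
    | succ d ih => rw [← add_assoc, hS, map_add, ih, hg0 _ _ _ (by omega), add_zero]
  refine ⟨f, fun l => ?_⟩
  rw [← hjet l 0, jetHom_eq_iff hq]
  intro i hi
  have h1 := (tendstoLocallyUniformlyOn_iteratedDeriv isOpen_compl_singleton hf
    (fun n => differentiableOn_ext0 _) i).tendsto_at (a := (p l : ℂ)) (p l).ne_zero
  -- The derivatives of the partial sums at $p_l$ are eventually constant, so the limit has the same
  -- ones.
  refine tendsto_nhds_unique h1 (tendsto_const_nhds.congr' ?_)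
  filter_upwards [Filter.eventually_ge_atTop (l + 1)] with N hN
  obtain ⟨d, rfl⟩ := Nat.exists_eq_add_of_le hN
  exact (jetHom_eq_iff hq _ _ _ _).1 ((hjet l 0).trans (hjet l d).symm) i hi

/-! ## The homomorphism -/

lemma jet_dil (logq : ℂ) (m : ℕ) (u c : ℂˣ) (f : Hol) :
    jet logq m u (dil c f) = jet logq m (c * u) f := by
  have h : (fun t : ℂ => (dil c f).1 (u * expU (t * logq))) =
      fun t : ℂ => f.1 (c * u * expU (t * logq)) := by
    funext t
    rw [mul_assoc]
    rfl
  simp only [jet, h]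

section phiEntry

variable {q : ℂˣ} (logq : ℂ) (s : ℂˣ) (m : ℕ)

lemma phiEntry_apply (x : QPDO q) (i j : ℤ) :
    (phiEntry logq s m x).1 i j = jetHom logq m (s * q ^ (-j)) (x.coeff (j - i)) := rfl

/-- The map on matrix entries as a linear map. -/
def phiEntryLin : QPDO q →ₗ[ℂ] Band (TruncPoly m) where
  toFun := phiEntry logq s m
  map_add' x y := by
    ext i j : 3
    exact map_add (jetHom logq m (s * q ^ (-j))) (x.coeff (j - i)) (y.coeff (j - i))
  map_smul' c x := by
    ext i j : 3
    exact map_smul (jetHom logq m (s * q ^ (-j))) c (x.coeff (j - i))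

lemma phiEntryLin_apply (x : QPDO q) : phiEntryLin logq s m x = phiEntry logq s m x := rfl

lemma phiEntry_one : phiEntry (q := q) logq s m 1 = 1 := by
  ext i j : 3
  have h1 : (1 : QPDO q).coeff (j - i) = if 0 = j - i then (1 : Hol) else 0 :=
    QPDO.coeff_mono 0 _ 1
  rw [phiEntry_apply, h1, Band.one_val]
  by_cases hij : i = j
  · rw [if_pos (by omega), map_one, hij, Matrix.one_apply_eq]
  · rw [if_neg (by omega), map_zero, Matrix.one_apply_ne hij]

lemma phiEntry_mono_mul_mono (a b : ℤ) (f g : Hol) :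
    phiEntry logq s m (QPDO.mono a f * QPDO.mono b g : QPDO q) =
      phiEntry (q := q) logq s m (QPDO.mono a f) * phiEntry (q := q) logq s m (QPDO.mono b g) := by
  ext i j : 3
  rw [QPDO.mono_mul_mono, phiEntry_apply, Band.mul_apply]
  simp only [phiEntry_apply, QPDO.coeff_mono]
  -- Column $j$ of the second factor is nonzero at most in row $j-b$, and $sq^{-(j-b)}=q^b\cdot
  -- sq^{-j}$ matches the dilation in the product.
  rw [finsum_eq_single _ (j - b)]
  · rw [if_pos (show b = j - (j - b) by ring)]
    by_cases h : a + b = j - i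
    · rw [if_pos h, if_pos (by omega), map_mul, jetHom_apply, jetHom_apply, jetHom_apply, jet_dil,
        mul_left_comm, ← zpow_add, show b + -j = -(j - b) by ring]
    · rw [if_neg h, if_neg (by omega), map_zero, map_zero, zero_mul]
  · intro k hk
    rw [if_neg (show ¬ b = j - k by omega), map_zero, mul_zero]

lemma phiEntry_mul (x y : QPDO q) :
    phiEntry logq s m (x * y) = phiEntry logq s m x * phiEntry logq s m y := by
  simp only [← phiEntryLin_apply]
  induction x using QPDO.induction_mono with
  | h0 => rw [zero_mul, map_zero, zero_mul]
  | hadd x x' hx hx' => rw [add_mul, map_add, map_add, hx, hx', add_mul]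
  | h1 a f =>
    induction y using QPDO.induction_mono with
    | h0 => rw [mul_zero, map_zero, mul_zero]
    | hadd y y' hy hy' => rw [mul_add, map_add, map_add, hy, hy', mul_add]
    | h1 b g => exact phiEntry_mono_mul_mono logq s m a b f g

/-- The map on matrix entries as an algebra homomorphism. -/
def phiEntryHom : QPDO q →ₐ[ℂ] Band (TruncPoly m) :=
  AlgHom.ofLinearMap (phiEntryLin logq s m) (phiEntry_one logq s m) (phiEntry_mul logq s m)

/-- `φ_s^{[m]}` as an algebra homomorphism. -/
def phiHom : SQPDO q →ₐ[ℂ] MInf m := (phiEntryHom logq s m).mapMatrix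

lemma phi_mem_gradeM (ε : ℤˣ) (α : HalfInt) {x : SQPDO q} (hx : x ∈ gradeS ε α) :
    phi logq s m x ∈ gradeM ε α := by
  rw [mem_gradeS] at hx
  rw [mem_gradeM]
  intro p r i j h
  refine hx p r (j - i) fun h0 => h ?_
  change jetHom logq m (s * q ^ (-j)) ((x p r).coeff (j - i)) = 0
  rw [h0, map_zero]

lemma phi_mem_parity (π : ZMod 2) {x : SQPDO q} (hx : x ∈ parity (QPDO q) π) :
    phi logq s m x ∈ parity (Band (TruncPoly m)) π := by
  intro p r h
  refine hx p r fun h0 => h ?_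
  change phiEntryLin logq s m (x p r) = 0
  rw [h0, map_zero]

variable {logq}

lemma phi_eq_zero_iff (hq : logq ≠ 0) (x : SQPDO q) :
    phi logq s m x = 0 ↔ x ∈ idealJ q s m := by
  have h1 : phi logq s m x = 0 ↔ ∀ p r i j,
      jetHom logq m (s * q ^ (-j)) ((x p r).coeff (j - i)) = 0 := by
    constructor
    · intro h p r i j
      exact congrArg (fun A : MInf m => (A p r).1 i j) h
    · intro h
      ext p r i j : 4
      exact h p r i j
  rw [h1]
  simp only [jetHom_eq_zero_iff _ _ hq]
  constructor
  · intro h p r k n i hi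
    -- Row $-n-k$ and column $-n$ single out the coefficient of $z^k$ at the point $sq^n$.
    have := h p r (-n - k) (-n) i hi
    rwa [neg_neg, sub_sub_cancel] at this
  · intro h p r i j d hd
    exact h p r (j - i) (-j) d hd

end phiEntry

/-! ## Surjectivity -/

lemma log_norm_ne_zero {q : ℂˣ} (hq : ‖(q : ℂ)‖ ≠ 1) : Real.log ‖(q : ℂ)‖ ≠ 0 :=
  Real.log_ne_zero_of_pos_of_ne_one (norm_pos_iff.2 q.ne_zero) hq

lemma tendsto_abs_log_norm_orbit {q : ℂˣ} (hq : ‖(q : ℂ)‖ ≠ 1) {n : ℕ} (s : Fin n → ℂˣ) :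
    Filter.Tendsto (fun a : Fin n × ℤ => |Real.log ‖((s a.1 * q ^ (-a.2) : ℂˣ) : ℂ)‖|)
      Filter.cofinite Filter.atTop := by
  have hL : 0 < |Real.log ‖(q : ℂ)‖| := abs_pos.2 (log_norm_ne_zero hq)
  rw [Filter.tendsto_atTop]
  intro b
  rw [Filter.eventually_cofinite]
  -- From $\log|s_iq^{-j}|=\log|s_i|-j\log|q|$, a value below $b$ in modulus forces $|j|\le M$,
  -- uniformly in $i$.
  set M : ℝ := (b + ∑ i, |Real.log ‖(s i : ℂ)‖|) / |Real.log ‖(q : ℂ)‖| with hM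
  refine (Set.finite_univ.prod (Set.finite_Icc (-⌈M⌉) ⌈M⌉)).subset ?_
  rintro ⟨i, j⟩ h
  refine ⟨Set.mem_univ _, ?_⟩
  rw [Set.mem_ofPred_eq, not_le] at h
  have h1 : Real.log ‖((s i * q ^ (-j) : ℂˣ) : ℂ)‖ =
      Real.log ‖(s i : ℂ)‖ - j * Real.log ‖(q : ℂ)‖ := by
    rw [Units.val_mul, Units.val_zpow_eq_zpow_val, norm_mul, norm_zpow,
      Real.log_mul (norm_ne_zero_iff.2 (s i).ne_zero)
        (zpow_ne_zero _ (norm_ne_zero_iff.2 q.ne_zero)), Real.log_zpow]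
    push_cast
    ring
  have h2 : |Real.log ‖(s i : ℂ)‖| ≤ ∑ i, |Real.log ‖(s i : ℂ)‖| :=
    Finset.single_le_sum (f := fun i => |Real.log ‖(s i : ℂ)‖|) (fun _ _ => abs_nonneg _)
      (Finset.mem_univ i)
  have h3 : |(j : ℝ)| ≤ M := by
    rw [hM, le_div_iff₀ hL, ← abs_mul]
    have h4 := abs_sub_abs_le_abs_sub ((j : ℝ) * Real.log ‖(q : ℂ)‖) (Real.log ‖(s i : ℂ)‖)
    rw [abs_sub_comm, ← h1] at h4
    change |Real.log ‖((s i * q ^ (-j) : ℂˣ) : ℂ)‖| < b at h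
    linarith
  change j ∈ Set.Icc (-⌈M⌉) ⌈M⌉
  rw [Set.mem_Icc, ← abs_le]
  have h5 : ((|j| : ℤ) : ℝ) ≤ (⌈M⌉ : ℝ) := by
    rw [Int.cast_abs]
    exact h3.trans (Int.le_ceil M)
  exact_mod_cast h5

/-- Within one orbit the absolute values differ. A coincidence between two orbits would give
$a_i-a_{i'}=(j-j')+l\,\tau^{-1}$, the second term being the $2\pi i$-ambiguity of the exponential.
-/
lemma orbit_injective {q : ℂˣ} (hq : ‖(q : ℂ)‖ ≠ 1) {logq τ : ℂ}
    (hlog : Complex.exp logq = (q : ℂ))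
    (hτ : τ = logq / (2 * (Real.pi : ℂ) * Complex.I)) {n : ℕ} {s : Fin n → ℂˣ} {a : Fin n → ℂ}
    (hs : ∀ i, (s i : ℂ) = Complex.exp (a i * logq))
    (ha : ∀ i j, i ≠ j → ¬ ∃ k l : ℤ, a i - a j = (k : ℂ) + τ⁻¹ * (l : ℂ)) (hq0 : logq ≠ 0) :
    Function.Injective (fun b : Fin n × ℤ => s b.1 * q ^ (-b.2)) := by
  rintro ⟨i, j⟩ ⟨i', j'⟩ h
  have h1 : s i * q ^ (-j) = s i' * q ^ (-j') := h
  by_cases hi : i = i'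
  · subst hi
    have h2 := congrArg (fun u : ℂˣ => ‖(u : ℂ)‖) (mul_left_cancel h1)
    simp only [Units.val_zpow_eq_zpow_val, norm_zpow] at h2
    have h3 := zpow_right_injective₀ (norm_pos_iff.2 q.ne_zero) hq h2
    rw [neg_injective h3]
  · exfalso
    have h2 := congrArg Units.val h1
    rw [Units.val_mul, Units.val_mul, Units.val_zpow_eq_zpow_val, Units.val_zpow_eq_zpow_val, hs,
      hs, ← hlog, ← Complex.exp_int_mul, ← Complex.exp_int_mul, ← Complex.exp_add,
      ← Complex.exp_add, Complex.exp_eq_exp_iff_exists_int] at h2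
    obtain ⟨l, hl⟩ := h2
    refine ha i i' hi ⟨j - j', l, ?_⟩
    have h3 : (2 * (Real.pi : ℂ) * Complex.I) ≠ 0 := Complex.two_pi_I_ne_zero
    rw [hτ, inv_div, ← mul_right_inj' hq0]
    field_simp
    push_cast at hl ⊢
    linear_combination hl

lemma exists_hol_orbit_jets {q : ℂˣ} (hq : ‖(q : ℂ)‖ ≠ 1) {logq : ℂ} (hq0 : logq ≠ 0)
    {n : ℕ} (s : Fin n → ℂˣ) (m : Fin n → ℕ)
    (hinj : Function.Injective (fun b : Fin n × ℤ => s b.1 * q ^ (-b.2)))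
    (r : ∀ i, ℤ → TruncPoly (m i)) :
    ∃ f : Hol, ∀ i j, jetHom logq (m i) (s i * q ^ (-j)) f = r i j := by
  -- The set of points can be enumerated by `ℕ` only if there is at least one orbit.
  rcases isEmpty_or_nonempty (Fin n) with h | h
  · exact ⟨0, fun i => h.elim i⟩
  obtain ⟨_⟩ := nonempty_denumerable (Fin n × ℤ)
  let e : ℕ ≃ Fin n × ℤ := (Denumerable.eqv (Fin n × ℤ)).symm
  have hlim := (tendsto_abs_log_norm_orbit hq s).comp e.injective.tendsto_cofinite
  rw [Nat.cofinite_eq_atTop] at hlim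
  obtain ⟨f, hf⟩ := exists_hol_jetHom_eq hq0 (hinj.comp e.injective) hlim
    (fun k => m (e k).1) (fun k => r (e k).1 (e k).2)
  refine ⟨f, fun i j => ?_⟩
  obtain ⟨k, hk⟩ := e.surjective (i, j)
  have h1 := hf k
  simp only [Function.comp_apply] at h1
  rw [hk] at h1
  exact h1

lemma exists_phiEntry_eq {q : ℂˣ} (hq : ‖(q : ℂ)‖ ≠ 1) {logq : ℂ} (hq0 : logq ≠ 0)
    {n : ℕ} (s : Fin n → ℂˣ) (m : Fin n → ℕ)
    (hinj : Function.Injective (fun b : Fin n × ℤ => s b.1 * q ^ (-b.2)))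
    (b : ∀ i, Band (TruncPoly (m i))) :
    ∃ x : QPDO q, ∀ i, phiEntry logq (s i) (m i) x = b i := by
  classical
  -- The $k$-th diagonals of all targets are realised by one function, independently of the other
  -- diagonals.
  choose f hf using fun k : ℤ =>
    exists_hol_orbit_jets hq hq0 s m hinj (fun i j => (b i).1 (j - k) j)
  choose N hN using fun i => (b i).2
  -- A common bound for all bandwidths: the diagonals beyond it vanish in every target, so a finite
  -- sum suffices.
  let K : ℤ := ∑ i, (N i : ℤ)
  let x : QPDO q := Finsupp.onFinset (Finset.Icc (-K) K)
    (fun k => if k ∈ Finset.Icc (-K) K then f k else 0) fun k hk => by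
      by_contra h
      exact hk (if_neg h)
  have hx : ∀ k, x.coeff k = if k ∈ Finset.Icc (-K) K then f k else 0 := fun k => rfl
  refine ⟨x, fun i => ?_⟩
  ext c d : 3
  rw [phiEntry_apply, hx]
  split_ifs with h
  · rw [hf, sub_sub_cancel]
  · rw [map_zero, hN i c d]
    have h1 : (N i : ℤ) ≤ K :=
      Finset.single_le_sum (f := fun i => (N i : ℤ)) (fun _ _ => Int.natCast_nonneg _)
        (Finset.mem_univ i)
    rw [Finset.mem_Icc, ← abs_le, not_le, abs_sub_comm] at h
    omega

end QuantumSuper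

end

/-! ### The exact sequence -/

theorem mainTheorem8 (q : ℂˣ) (hq : ‖(q : ℂ)‖ ≠ 1)
    (logq τ : ℂ) (hlog : Complex.exp logq = (q : ℂ))
    (hτ : τ = logq / (2 * (Real.pi : ℂ) * Complex.I))
    (n : ℕ) (s : Fin n → ℂˣ) (a : Fin n → ℂ) (m : Fin n → ℕ)
    (hs : ∀ i, (s i : ℂ) = Complex.exp (a i * logq))
    (ha : ∀ i j, i ≠ j → ¬ ∃ k l : ℤ, a i - a j = (k : ℂ) + τ⁻¹ * (l : ℂ))
    (ε : ℤˣ)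
    (J : Submodule ℂ (QuantumSuper.SQPDO q))
    (hJ : J = ⨅ i, QuantumSuper.idealJ q (s i) (m i)) :
    -- the middle term and the right-hand term are graded superalgebras
    QuantumSuper.IsHalfIntGradedSuperalgebra (A := QuantumSuper.SQPDO q)
      (QuantumSuper.gradeS ε) (QuantumSuper.parity (QuantumSuper.QPDO q)) ∧
    QuantumSuper.IsHalfIntGradedSuperalgebra (A := (i : Fin n) → QuantumSuper.MInf (m i))
      (fun α => Submodule.pi Set.univ fun _ => QuantumSuper.gradeM ε α)
      (fun π => Submodule.pi Set.univ fun i =>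
        QuantumSuper.parity (QuantumSuper.Band (QuantumSuper.TruncPoly (m i))) π) ∧
    -- the left-hand term is a graded two-sided ideal
    (∀ x ∈ J, ∀ y, x * y ∈ J ∧ y * x ∈ J) ∧
    J = ⨆ α, J ⊓ QuantumSuper.gradeS ε α ∧
    J = ⨆ π, J ⊓ QuantumSuper.parity (QuantumSuper.QPDO q) π ∧
    -- the map is a homomorphism of graded superalgebras and the sequence is exact
    ∃ Φ : QuantumSuper.SQPDO q →ₐ[ℂ] ((i : Fin n) → QuantumSuper.MInf (m i)),
      (∀ x i, Φ x i = QuantumSuper.phi logq (s i) (m i) x) ∧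
      (∀ (α : QuantumSuper.HalfInt), ∀ x ∈ QuantumSuper.gradeS (q := q) ε α, ∀ i,
        Φ x i ∈ QuantumSuper.gradeM ε α) ∧
      (∀ π, ∀ x ∈ QuantumSuper.parity (QuantumSuper.QPDO q) π, ∀ i,
        Φ x i ∈ QuantumSuper.parity (QuantumSuper.Band (QuantumSuper.TruncPoly (m i))) π) ∧
      Function.Injective J.subtype ∧
      Function.Exact J.subtype Φ ∧
      Function.Surjective Φ := by
  -- Otherwise $q=1$, against $|q|\ne1$.
  have hq0 : logq ≠ 0 := by
    rintro rfl
    rw [← hlog] at hq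
    simp at hq
  have hinj := QuantumSuper.orbit_injective hq hlog hτ hs ha hq0
  let Φ : QuantumSuper.SQPDO q →ₐ[ℂ] ((i : Fin n) → QuantumSuper.MInf (m i)) :=
    AlgHom.pi fun i => QuantumSuper.phiHom logq (s i) (m i)
  have hΦ : ∀ x i, Φ x i = QuantumSuper.phi logq (s i) (m i) x := fun x i => rfl
  have hker : ∀ x, x ∈ J ↔ Φ x = 0 := by
    intro x
    rw [hJ, Submodule.mem_iInf, funext_iff]
    exact forall_congr' fun i => (QuantumSuper.phi_eq_zero_iff (s i) (m i) hq0 x).symm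
  refine ⟨QuantumSuper.isHalfIntGradedSuperalgebra_SQPDO q ε,
    QuantumSuper.isHalfIntGradedSuperalgebra_MInf m ε, fun x hx y => ?_,
    QuantumSuper.idealJ_eq_iSup_gradeS ε J s m hJ, QuantumSuper.idealJ_eq_iSup_parity J s m hJ,
    Φ, hΦ, fun α x hx i => QuantumSuper.phi_mem_gradeM logq (s i) (m i) ε α hx,
    fun π x hx i => QuantumSuper.phi_mem_parity logq (s i) (m i) π hx,
    Subtype.val_injective, fun x => ?_, fun B => ?_⟩
  -- `J` is a two-sided ideal because it is the kernel of `Φ`.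
  · rw [hker] at hx
    rw [hker, hker, map_mul, map_mul, hx, zero_mul, mul_zero]
    exact ⟨rfl, rfl⟩
  · rw [← hker]
    exact ⟨fun h => ⟨⟨x, h⟩, rfl⟩, fun ⟨y, hy⟩ => hy ▸ y.2⟩
  -- The four blocks are solved separately, each for all $i$ at once.
  · choose x hx using fun p r : Fin 2 =>
      QuantumSuper.exists_phiEntry_eq hq hq0 s m hinj (fun i => B i p r)
    refine ⟨x, ?_⟩
    funext i
    ext p r : 2
    exact congrArg Subtype.val (hx p r i)
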